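/- Let $\mathcal P_8$ be the regular octahedron with edge length $1$. Label its faces $F_1,\dots,F_8$ so that its six vertices are incident exactly to the faces with indices $\{1,4,6,7\}$, $\{1,2,5,6\}$, $\{1,2,3,4\}$, $\{2,3,5,8\}$, $\{3,4,7,8\}$, $\{5,6,7,8\}$ respectively, and so that $F_2,F_4,F_6$ occur around $F_1$ in clockwise order as seen from outside. A *landscape* of $\mathcal P_8$ is the union of the faces on a path with at least two vertices in the dual graph of a net of $\mathcal P_8$; the path (a subgraph, without preferred direction) is its dual graph. A landscape $L'$ is a *sublandscape* of $L$ if the dual graph of $L'$ is a subgraph of that of $L$. An *orientation* of $L$ is an unfolding of $L$ into $\mathbb R^2$: each face is mapped isometrically with its exterior side up, consecutive faces of the path stay joined along their common edge, one face $F_n$ of $L$ lies in the upper half-plane, and the edge of $F_n$ shared with some adjacent face $F_m$ of $\mathcal P_8$ is mapped onto the segment from $(0,0)$ to $(1,0)$. For points $p_1,p_2$ of the surface lying in $L$, $|T_L(p_1,p_2)|$ is the length of the line segment joining their images in an orientation of $L$ if this segment is contained in the image of $L$, and $\infty$ otherwise (if a point has several images, because it lies on an edge along which $L$ is not joined, the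 shortest such segment is taken). A landscape $L$ is *valid* if there are points $p_1,p_2\in L$ such that for every other landscape $L'$ with $p_1,p_2\in L'$ we have $|T_L(p_1,p_2)|\le |T_{L'}(p_1,p_2)|$ and, in case of equality, $L'$ is not a sublandscape of $L$. Call a permutation $(n_1,\dots,n_8)$ of $(1,\dots,8)$ a *labelling* if $F_{n_b}$ and $F_{n_c}$ are opposite whenever $b+c=9$, and $F_{n_2},F_{n_4},F_{n_6}$ are the neighbours of $F_{n_1}$ and occur around $F_{n_1}$ in clockwise order as seen from outside. For a labelling, let $L_1,\dots,L_9$ be the landscapes whose dual graphs are the paths $$L_1: F_{n_1}F_{n_2},\quad L_2: F_{n_1}F_{n_2}F_{n_5},\quad L_3: F_{n_1}F_{n_6}F_{n_5},$$ $$L_4: F_{n_1}F_{n_6}F_{n_5}F_{n_8},\quad L_5: F_{n_1}F_{n_2}F_{n_3}F_{n_8},\quad L_6: F_{n_1}F_{n_4}F_{n_7}F_{n_8},$$ $$L_7: F_{n_1}F_{n_6}F_{n_7}F_{n_8},\quad L_8: F_{n_1}F_{n_2}F_{n_5}F_{n_8},\quad L_9: F_{n_1}F_{n_4}F_{n_3}F_{n_8}.$$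 **Theorem.** Let $L$ be a landscape of $\mathcal P_8$. If $L$ is not one of $L_1,\dots,L_9$ for any labelling $(n_1,\dots,n_8)$, then $L$ is not valid. -/

import Mathlib

open scoped ENNReal

/-- The eight faces of the octahedron. -/
inductive Face
  | F1 | F2 | F3 | F4 | F5 | F6 | F7 | F8
  deriving DecidableEq

instance : Fintype Face where
  elems := {.F1, .F2, .F3, .F4, .F5, .F6, .F7, .F8}
  complete n := by cases n <;> decide

/-- The six vertices of the octahedron, each named after the four faces incident to it. -/
inductive Vertex
  | v1467 | v1256 | v1234 | v2358 | v3478 | v5678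
  deriving DecidableEq

instance : Fintype Vertex where
  elems := {.v1467, .v1256, .v1234, .v2358, .v3478, .v5678}
  complete v := by cases v <;> decide

/-- The four faces incident to a vertex. -/
def Vertex.faces : Vertex → Finset Face
  | .v1467 => {.F1, .F4, .F6, .F7}
  | .v1256 => {.F1, .F2, .F5, .F6}
  | .v1234 => {.F1, .F2, .F3, .F4}
  | .v2358 => {.F2, .F3, .F5, .F8}
  | .v3478 => {.F3, .F4, .F7, .F8}
  | .v5678 => {.F5, .F6, .F7, .F8}

/-- The vertices of the octahedron of edge length `√2`, in integer coordinates. -/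
def Vertex.coords : Vertex → Fin 3 → ℤ
  | .v1467 => ![1, 0, 0]
  | .v1234 => ![0, 1, 0]
  | .v1256 => ![0, 0, 1]
  | .v2358 => ![-1, 0, 0]
  | .v5678 => ![0, -1, 0]
  | .v3478 => ![0, 0, -1]

/-- The position in space of a vertex of the unit octahedron (all edges have length `1`). -/
noncomputable def Vertex.pos (v : Vertex) : EuclideanSpace ℝ (Fin 3) :=
  WithLp.toLp 2 (fun i => (v.coords i : ℝ) / √2)

namespace Face

/-- The three vertices of a face. -/
def verts (n : Face) : Finset Vertex := Finset.univ.filter (fun v => n ∈ v.faces)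

/-- A face, as a (closed) triangle in space. -/
def carrier (n : Face) : Set (EuclideanSpace ℝ (Fin 3)) :=
  convexHull ℝ (Vertex.pos '' {v | v ∈ n.verts})

/-- Two faces are adjacent if they share an edge, i.e. have exactly two common vertices. -/
def adjGraph : SimpleGraph Face where
  Adj n m := (n.verts ∩ m.verts).card = 2
  symm := ⟨fun n m h => by rwa [Finset.inter_comm]⟩
  loopless := ⟨fun n h => by revert h; cases n <;> decide⟩

/-- Two faces are opposite if they have no common vertex. -/
def Opposite (n m : Face) : Prop := Disjoint n.verts m.verts

/-- A positive multiple of the centre of a face. -/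
def centre (n : Face) : Fin 3 → ℤ := ∑ v ∈ n.verts, v.coords

/-- The faces `a`, `b`, `c` are the neighbours of `m`, and they occur around `m` in this clockwise
order when seen from outside the octahedron. -/
def ClockwiseAround (m a b c : Face) : Prop :=
  adjGraph.Adj m a ∧ adjGraph.Adj m b ∧ adjGraph.Adj m c ∧
    Matrix.det (Matrix.of ![a.centre, b.centre, c.centre]) < 0

end Face

/-- The vertices `a`, `b`, `c` of a face occur in counterclockwise order around that face
when seen from outside the octahedron (the centre of the octahedron is the origin). -/
def Vertex.Counterclockwise (a b c : Vertex) : Prop :=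
  0 < Matrix.det (Matrix.of ![a.coords, b.coords, c.coords])

/-- The points `a`, `b`, `c` of the plane occur in counterclockwise order. -/
def PlaneCounterclockwise (a b c : EuclideanSpace ℝ (Fin 2)) : Prop :=
  0 < (b 0 - a 0) * (c 1 - a 1) - (b 1 - a 1) * (c 0 - a 0)

/-- `g` unfolds the faces in `H` into the plane: `g n` is the map on the face `n`, it preserves
distances on that face and shows its exterior side to the viewer, and two faces joined in `H` stay
glued along the edge they share. -/
structure IsUnfolding (H : Face.adjGraph.Subgraph)
    (g : Face → EuclideanSpace ℝ (Fin 3) → EuclideanSpace ℝ (Fin 2)) : Prop where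
  isometric : ∀ n ∈ H.verts, ∀ x ∈ n.carrier, ∀ y ∈ n.carrier, dist (g n x) (g n y) = dist x y
  exterior_up : ∀ n ∈ H.verts, ∀ a ∈ n.verts, ∀ b ∈ n.verts, ∀ c ∈ n.verts,
    a.Counterclockwise b c → PlaneCounterclockwise (g n a.pos) (g n b.pos) (g n c.pos)
  glued : ∀ n m, H.Adj n m → ∀ x ∈ n.carrier ∩ m.carrier, g n x = g m x

/-- `N` is the dual graph of a net: a spanning tree of the face adjacency graph along which all
eight faces unfold into the plane without overlap. -/
def IsNet (N : Face.adjGraph.Subgraph) : Prop :=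
  N.IsSpanning ∧ N.spanningCoe.IsTree ∧
    ∃ g, IsUnfolding N g ∧ ∀ n m : Face, n ≠ m →
      Disjoint (interior (g n '' n.carrier)) (interior (g m '' m.carrier))

/-- `H` is the path that visits the faces in the list `l`, in this order. -/
def IsPathThrough (H : Face.adjGraph.Subgraph) (l : List Face) : Prop :=
  ∃ (a b : Face) (w : Face.adjGraph.Walk a b), w.IsPath ∧ w.support = l ∧ H = w.toSubgraph

/-- A landscape, given by its dual graph: a path with at least two vertices in the dual graph of
a net. It has no preferred direction. -/
@[ext] structure Landscape where
  dual : Face.adjGraph.Subgraph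
  exists_path : ∃ l : List Face, 2 ≤ l.length ∧ IsPathThrough dual l
  exists_net : ∃ N, IsNet N ∧ dual ≤ N

namespace Landscape

/-- The points of the surface of the octahedron that lie on a face of the landscape. -/
def carrier (L : Landscape) : Set (EuclideanSpace ℝ (Fin 3)) := ⋃ n ∈ L.dual.verts, n.carrier

/-- `L'` is a sublandscape of `L`. -/
def IsSublandscape (L' L : Landscape) : Prop := L'.dual ≤ L.dual

/-- `g` is the function defining the orientation `(L, n, m)`: it unfolds `L` into the plane, with
the face `n` in the upper half-plane and the edge shared by `n` and `m` on the segment from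
`(0, 0)` to `(1, 0)`. -/
structure IsOrientation (L : Landscape) (n m : Face)
    (g : Face → EuclideanSpace ℝ (Fin 3) → EuclideanSpace ℝ (Fin 2)) : Prop where
  mem : n ∈ L.dual.verts
  adj : Face.adjGraph.Adj n m
  unfolding : IsUnfolding L.dual g
  upper : ∀ x ∈ n.carrier, 0 ≤ g n x 1
  base : g n '' (n.carrier ∩ m.carrier) = segment ℝ !₂[0, 0] !₂[1, 0]

/-- The planar region covered by the unfolded landscape. -/
def region (L : Landscape)
    (g : Face → EuclideanSpace ℝ (Fin 3) → EuclideanSpace ℝ (Fin 2)) :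
    Set (EuclideanSpace ℝ (Fin 2)) :=
  ⋃ n ∈ L.dual.verts, g n '' n.carrier

/-- The places of the surface point `p` in the unfolded landscape. There is more than one only if
`p` lies on an edge along which the landscape is not glued. -/
def places (L : Landscape)
    (g : Face → EuclideanSpace ℝ (Fin 3) → EuclideanSpace ℝ (Fin 2))
    (p : EuclideanSpace ℝ (Fin 3)) : Set (EuclideanSpace ℝ (Fin 2)) :=
  {q | ∃ n ∈ L.dual.verts, p ∈ n.carrier ∧ g n p = q}

/-- The length of the trail from `p₁` to `p₂` in `L`, that is of the line segment between their
places in an orientation of `L`, provided that it stays inside the region of the orientation;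
it is `∞` if there is no such segment. (If a point has several places, the shortest such segment
is taken; the choice of the orientation does not matter.) -/
noncomputable def trailLength (L : Landscape) (p₁ p₂ : EuclideanSpace ℝ (Fin 3)) : ℝ≥0∞ :=
  sInf {d | ∃ n m g, L.IsOrientation n m g ∧ ∃ q₁ ∈ L.places g p₁, ∃ q₂ ∈ L.places g p₂,
    segment ℝ q₁ q₂ ⊆ L.region g ∧ d = edist q₁ q₂}

/-- The landscape `L` is valid. -/
def IsValid (L : Landscape) : Prop :=
  ∃ p₁ ∈ L.carrier, ∃ p₂ ∈ L.carrier, ∀ L' : Landscape, L' ≠ L →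
    p₁ ∈ L'.carrier → p₂ ∈ L'.carrier →
      L.trailLength p₁ p₂ ≤ L'.trailLength p₁ p₂ ∧
      (L.trailLength p₁ p₂ = L'.trailLength p₁ p₂ → ¬ L'.IsSublandscape L)

end Landscape

/-- `σ` renames the faces `F_i` to `F_{n_i}` in an admissible way: faces whose indices add up to
nine are opposite, and `F_{n_2}`, `F_{n_4}`, `F_{n_6}` occur around `F_{n_1}` in the same clockwise
order as `F_2`, `F_4`, `F_6` occur around `F_1`. -/
def IsLabelling (σ : Equiv.Perm Face) : Prop :=
  (σ .F1).Opposite (σ .F8) ∧ (σ .F2).Opposite (σ .F7) ∧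
  (σ .F3).Opposite (σ .F6) ∧ (σ .F4).Opposite (σ .F5) ∧
  Face.ClockwiseAround (σ .F1) (σ .F2) (σ .F4) (σ .F6)

/-- The faces of the nine landscapes `L_1, …, L_9` (here indexed from `0`), in order, for the
labelling `n_i = i`. -/
def nineLists : Fin 9 → List Face
  | 0 => [.F1, .F2]
  | 1 => [.F1, .F2, .F5]
  | 2 => [.F1, .F6, .F5]
  | 3 => [.F1, .F6, .F5, .F8]
  | 4 => [.F1, .F2, .F3, .F8]
  | 5 => [.F1, .F4, .F7, .F8]
  | 6 => [.F1, .F6, .F7, .F8]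
  | 7 => [.F1, .F2, .F5, .F8]
  | 8 => [.F1, .F4, .F3, .F8]

/-- `L` is one of the nine landscapes `L_1, …, L_9` for the labelling `σ`. -/
def Landscape.IsOneOfNine (L : Landscape) (σ : Equiv.Perm Face) : Prop :=
  ∃ a : Fin 9, IsPathThrough L.dual ((nineLists a).map σ)

/-!
A face of the octahedron is a triple of signs: it has one vertex on each coordinate axis. Its three
neighbours arise by a change of one sign (`Face.flip`), so a walk on the faces is a face together
with a word in the three axes. The nine landscapes are exactly the walks whose words are nonempty
and have no repeated letters (`straightWords`, `exists_isLabelling`). Unfolded into the plane, their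
faces are consecutive triangles of a strip and form a convex region, so that they contain the
segment between any two points of their first and last face (`IsUnfolding.segment_subset`).

Unfolding across an edge reflects the opposite vertex in the midpoint of this edge. Hence the squared
distances `sqDist w i j` between the vertices of the first and of the last face of a walk are integers
that can be computed from its word `w`. For points `p₁`, `p₂` of these faces with barycentric
coordinates `xᵢ`, `yⱼ`, the squared distance of the unfolded points is
`∑ i, ∑ j, xᵢ * yⱼ * sqDist w i j`, up to terms that depend on `p₁` and `p₂` but not on the walk
(`IsUnfolding.sq_dist_eq`). So two walks between the same faces can be compared entry by entry in
their tables of integers. A finite computation (`exists_isShortcut`) shows that every other walk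
without repeated faces has a *shortcut*, a walk without repeated letters to the same face whose
entries are at most as large; it makes the distance strictly smaller unless `p₁` lies on the second
face or `p₂` on the last but one.

Now suppose that a landscape `L` other than the nine is valid for `p₁`, `p₂`. Its trail has finite
length, since some landscape among the nine contains a trail, and joins the places of `p₁`, `p₂` on
two faces of `L`. Consider a shortest walk in `L` between faces that show them at these places
(`Landscape.not_trailLength_eq`). If its word has no repeated letters, this walk is a proper
sublandscape of `L` with a trail of the same length; otherwise its shortcut is a landscape with a
shorter trail. Both are impossible. That the walks without repeated letters are landscapes requires
a net around each of them: a strip of six faces with two more faces attached (`isNet_net`).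
-/

/-! ### Faces as sign triples -/

namespace Face

/-- The vertex of a face on the `i`-th coordinate axis. Every face has exactly one vertex on each of
the three axes. -/
def vertexAt : Face → Fin 3 → Vertex
  | .F1 => ![.v1467, .v1234, .v1256]
  | .F2 => ![.v2358, .v1234, .v1256]
  | .F3 => ![.v2358, .v1234, .v3478]
  | .F4 => ![.v1467, .v1234, .v3478]
  | .F5 => ![.v2358, .v5678, .v1256]
  | .F6 => ![.v1467, .v5678, .v1256]
  | .F7 => ![.v1467, .v5678, .v3478]
  | .F8 => ![.v2358, .v5678, .v3478]

/-- The neighbour of a face that has the antipodal vertex on the `k`-th axis. -/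
def flip : Face → Fin 3 → Face
  | .F1 => ![.F2, .F6, .F4]
  | .F2 => ![.F1, .F5, .F3]
  | .F3 => ![.F4, .F8, .F2]
  | .F4 => ![.F3, .F7, .F1]
  | .F5 => ![.F6, .F2, .F8]
  | .F6 => ![.F5, .F1, .F7]
  | .F7 => ![.F8, .F4, .F6]
  | .F8 => ![.F7, .F3, .F5]

/-- The sign, on the `i`-th axis, of the points in the relative interior of a face. -/
def sgn (n : Face) (i : Fin 3) : ℤ := (n.vertexAt i).coords i

/-- The product of the three signs of a face; it is `1` if the vertices on the axes `0`, `1`, `2`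
occur in counterclockwise order, and `-1` otherwise. -/
def handedness (n : Face) : ℤ := n.sgn 0 * n.sgn 1 * n.sgn 2

theorem mem_verts_iff (n : Face) (v : Vertex) : v ∈ n.verts ↔ ∃ i, n.vertexAt i = v := by
  revert n v; decide

theorem adj_iff (n m : Face) : adjGraph.Adj n m ↔ ∃ k, m = n.flip k := by
  change (n.verts ∩ m.verts).card = 2 ↔ _
  revert n m; decide

theorem adj_flip (n : Face) (k : Fin 3) : adjGraph.Adj n (n.flip k) :=
  (n.adj_iff _).2 ⟨k, rfl⟩

theorem flip_flip (n : Face) (k : Fin 3) : (n.flip k).flip k = n := by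
  revert n k; decide

theorem flip_comm (n : Face) (k l : Fin 3) : (n.flip k).flip l = (n.flip l).flip k := by
  revert n k l; decide

theorem vertexAt_flip_of_ne (n : Face) {k j : Fin 3} (h : j ≠ k) :
    (n.flip k).vertexAt j = n.vertexAt j := by
  revert n k j; decide

theorem coords_vertexAt (n : Face) (i j : Fin 3) :
    (n.vertexAt i).coords j = if i = j then n.sgn i else 0 := by
  revert n i j; decide

theorem sgn_flip (n : Face) (k j : Fin 3) :
    (n.flip k).sgn j = if j = k then -n.sgn j else n.sgn j := by
  revert n k j; decide

theorem sgn_mul_self (n : Face) (i : Fin 3) : n.sgn i * n.sgn i = 1 := by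
  revert n i; decide

theorem handedness_flip (n : Face) (k : Fin 3) : (n.flip k).handedness = -n.handedness := by
  revert n k; decide

theorem handedness_eq (n : Face) : n.handedness = 1 ∨ n.handedness = -1 := by
  revert n; decide

/-! ### Words in the three axes as walks on the faces -/

/-- The last face of the walk that starts at `n` and flips the axes in the word `w` in turn. -/
def flips : Face → List (Fin 3) → Face
  | n, [] => n
  | n, k :: w => (n.flip k).flips w

/-- The list of faces visited by the walk that starts at `n` and flips the axes in `w` in turn. -/
def trail : Face → List (Fin 3) → List Face
  | n, [] => [n]
  | n, k :: w => n :: (n.flip k).trail w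

theorem flips_append (n : Face) (w w' : List (Fin 3)) :
    n.flips (w ++ w') = (n.flips w).flips w' := by
  induction w generalizing n with
  | nil => rfl
  | cons k w ih => exact ih _

theorem flips_flip_comm (n : Face) (w : List (Fin 3)) (k : Fin 3) :
    (n.flip k).flips w = (n.flips w).flip k := by
  induction w generalizing n with
  | nil => rfl
  | cons l w ih => rw [flips, flips, flip_comm, ih]

theorem flips_comm (n : Face) (w u : List (Fin 3)) :
    (n.flips u).flips w = (n.flips w).flips u := by
  induction u generalizing n with
  | nil => rfl
  | cons k u ih => rw [flips, flips, ih, flips_flip_comm]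

theorem handedness_flips (n : Face) (w : List (Fin 3)) :
    (n.flips w).handedness = (-1) ^ w.length * n.handedness := by
  induction w generalizing n with
  | nil => simp [flips]
  | cons k w ih => rw [flips, ih, handedness_flip, List.length_cons, pow_succ]; ring

theorem exists_flips_eq (n : Face) : ∃ u, F1.flips u = n := by
  have : ∃ u ∈ [[], [0], [1], [2], [0, 1], [0, 2], [1, 2], [0, 1, 2]], F1.flips u = n := by
    revert n; decide
  obtain ⟨u, -, h⟩ := this
  exact ⟨u, h⟩

theorem trail_flips (n : Face) (u w : List (Fin 3)) :
    (n.flips u).trail w = (n.trail w).map (fun x => x.flips u) := by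
  induction w generalizing n with
  | nil => rfl
  | cons k w ih => rw [trail, trail, List.map_cons, ← ih, flips_flip_comm]

theorem trail_append_singleton (n : Face) (w : List (Fin 3)) (k : Fin 3) :
    n.trail (w ++ [k]) = n.trail w ++ [(n.flips w).flip k] := by
  induction w generalizing n with
  | nil => rfl
  | cons l w ih => simp [trail, flips, ih]

theorem length_trail (n : Face) (w : List (Fin 3)) : (n.trail w).length = w.length + 1 := by
  induction w generalizing n with
  | nil => rfl
  | cons l w ih => simp [trail, ih]

/-- Whether a walk visits a face twice depends on its word only. -/
theorem nodup_trail_F1 {n : Face} {w : List (Fin 3)} (h : (n.trail w).Nodup) :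
    (F1.trail w).Nodup := by
  obtain ⟨u, rfl⟩ := exists_flips_eq n
  rw [trail_flips] at h
  exact h.of_map _

/-- Whether two walks from the same face end at the same face depends on their words only. -/
theorem flips_eq_of_F1 {w w' : List (Fin 3)} (h : F1.flips w = F1.flips w') (n : Face) :
    n.flips w = n.flips w' := by
  obtain ⟨u, rfl⟩ := exists_flips_eq n
  rw [flips_comm, h, flips_comm]

end Face

/-! ### Squared distances along a word -/

/-- The integers `r j` stand for the squared distances of a fixed point of the plane from the
vertices of an unfolded face, the vertices being numbered by their axes. `stepRow k r` are the
squared distances of this point from the vertices of the next face, across the edge opposite to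
the `k`-th vertex. -/
def stepRow (k : Fin 3) (r : Fin 3 → ℤ) : Fin 3 → ℤ :=
  match k with
  | 0 => ![r 1 + r 2 - r 0 + 1, r 1, r 2]
  | 1 => ![r 0, r 0 + r 2 - r 1 + 1, r 2]
  | 2 => ![r 0, r 1, r 0 + r 1 - r 2 + 1]

/-- The effect of `stepRow` for all letters of a word in turn. -/
def distRow (r : Fin 3 → ℤ) : List (Fin 3) → Fin 3 → ℤ
  | [] => r
  | k :: w => distRow (stepRow k r) w

/-- The squared distance, in the plane, between the `i`-th vertex of the first face and the `j`-th
vertex of the last face, when the faces on the walk with word `w` are unfolded. -/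
def sqDist (w : List (Fin 3)) (i : Fin 3) : Fin 3 → ℤ :=
  distRow (fun j => if i = j then 0 else 1) w

/-- The words without repeated letters, apart from the empty one. They belong to the walks of the
nine landscapes. -/
def straightWords : List (List (Fin 3)) :=
  [[0], [1], [2], [0, 1], [0, 2], [1, 0], [1, 2], [2, 0], [2, 1],
    [0, 1, 2], [0, 2, 1], [1, 0, 2], [1, 2, 0], [2, 0, 1], [2, 1, 0]]

/-- The words of length `k` whose walks do not visit a face twice. -/
def simpleWords : ℕ → List (List (Fin 3))
  | 0 => [[]]
  | k + 1 => (simpleWords k).flatMap fun w =>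
      ([0, 1, 2].map fun a => w ++ [a]).filter fun w' => (Face.F1.trail w').Nodup

theorem mem_simpleWords {w : List (Fin 3)} (h : (Face.F1.trail w).Nodup) :
    w ∈ simpleWords w.length := by
  induction w using List.reverseRecOn with
  | nil => simp [simpleWords]
  | append_singleton w a ih =>
    have h' := h
    rw [Face.trail_append_singleton] at h'
    rw [List.length_append, List.length_singleton, simpleWords, List.mem_flatMap]
    refine ⟨w, ih h'.of_append_left, ?_⟩
    simp only [List.mem_filter, List.mem_map, decide_eq_true_eq]
    exact ⟨⟨a, by fin_cases a <;> simp, rfl⟩, h⟩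

/-- The word `w'` is a *shortcut* of `w` if it leads to the same face, and all distances between the
vertices of the first and the last face are at most as long for `w'` as for `w`; the one between the
vertices that are not in the second and the last but one face of `w`, respectively, has to be
shorter. The default letter `0` plays no role, as only nonempty words `w` are considered. -/
def IsShortcut (w w' : List (Fin 3)) : Prop :=
  Face.F1.flips w = Face.F1.flips w' ∧ (∀ i j, sqDist w' i j ≤ sqDist w i j) ∧
    sqDist w' (w.headD 0) (w.getLastD 0) < sqDist w (w.headD 0) (w.getLastD 0)

instance (w w' : List (Fin 3)) : Decidable (IsShortcut w w') := by
  unfold IsShortcut; infer_instance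

theorem exists_isShortcut_of_mem : ∀ k < 8, ∀ w ∈ simpleWords k,
    w = [] ∨ w ∈ straightWords ∨ ∃ w' ∈ straightWords, IsShortcut w w' := by
  decide +kernel

/-- The combinatorial heart of the matter: every walk without repeated faces has a shortcut, unless
its word has no repeated letters. -/
theorem exists_isShortcut {n : Face} {w : List (Fin 3)} (h : (n.trail w).Nodup) (h0 : w ≠ [])
    (hw : w ∉ straightWords) : ∃ w' ∈ straightWords, IsShortcut w w' := by
  have h1 := Face.nodup_trail_F1 h
  have h8 := h1.length_le_card
  rw [Face.length_trail, show Fintype.card Face = 8 from rfl] at h8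
  rcases exists_isShortcut_of_mem _ (by omega) w (mem_simpleWords h1) with h | h | h
  · exact absurd h h0
  · exact absurd h hw
  · exact h

/-! ### Distances between weighted sums of points -/

section WeightedSums

variable {ι κ E F : Type*} [Fintype ι] [Fintype κ]
  [NormedAddCommGroup E] [InnerProductSpace ℝ E] [NormedAddCommGroup F] [InnerProductSpace ℝ F]

theorem sum_mul_sq_dist {x : ι → ℝ} {y : κ → ℝ} (hx : ∑ i, x i = 1) (hy : ∑ j, y j = 1)
    (a : ι → E) (b : κ → E) :
    ∑ i, ∑ j, x i * y j * dist (a i) (b j) ^ 2 =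
      ∑ i, x i * ‖a i‖ ^ 2 + ∑ j, y j * ‖b j‖ ^ 2 -
        2 * inner ℝ (∑ i, x i • a i) (∑ j, y j • b j) := by
  have h1 : ∑ i, x i * ‖a i‖ ^ 2 = ∑ i, ∑ j, x i * y j * ‖a i‖ ^ 2 := by
    refine Finset.sum_congr rfl fun i _ => ?_
    rw [← Finset.sum_mul, ← Finset.mul_sum, hy, mul_one]
  have h2 : ∑ j, y j * ‖b j‖ ^ 2 = ∑ i, ∑ j, x i * y j * ‖b j‖ ^ 2 := by
    rw [Finset.sum_comm]
    refine Finset.sum_congr rfl fun j _ => ?_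
    rw [← Finset.sum_mul, ← Finset.sum_mul, hx, one_mul]
  rw [h1, h2, sum_inner, Finset.mul_sum, ← Finset.sum_add_distrib, ← Finset.sum_sub_distrib]
  refine Finset.sum_congr rfl fun i _ => ?_
  rw [inner_sum, Finset.mul_sum, ← Finset.sum_add_distrib, ← Finset.sum_sub_distrib]
  refine Finset.sum_congr rfl fun j _ => ?_
  rw [dist_eq_norm, norm_sub_sq_real, real_inner_smul_left, real_inner_smul_right]
  ring

/-- The squared distance of two weighted means is bilinear in the weights, up to the terms
`∑ xᵢ xⱼ |aᵢ - aⱼ|² / 2` and `∑ yᵢ yⱼ |bᵢ - bⱼ|² / 2`, which depend on one family only. -/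
theorem sq_dist_sum_smul {x : ι → ℝ} {y : κ → ℝ} (hx : ∑ i, x i = 1) (hy : ∑ j, y j = 1)
    (a : ι → E) (b : κ → E) :
    dist (∑ i, x i • a i) (∑ j, y j • b j) ^ 2 =
      ∑ i, ∑ j, x i * y j * dist (a i) (b j) ^ 2 -
        (∑ i, ∑ j, x i * x j * dist (a i) (a j) ^ 2) / 2 -
        (∑ i, ∑ j, y i * y j * dist (b i) (b j) ^ 2) / 2 := by
  rw [sum_mul_sq_dist hx hy, sum_mul_sq_dist hx hx, sum_mul_sq_dist hy hy, dist_eq_norm,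
    norm_sub_sq_real, real_inner_self_eq_norm_sq, real_inner_self_eq_norm_sq]
  ring

/-- A map that preserves distances on a set preserves weighted means within this set. -/
theorem map_sum_smul_of_dist_eq {f : E → F} {s : Set E}
    (hf : ∀ p ∈ s, ∀ q ∈ s, dist (f p) (f q) = dist p q) {x : ι → ℝ} (hx : ∑ i, x i = 1)
    {a : ι → E} (ha : ∀ i, a i ∈ s) (hs : ∑ i, x i • a i ∈ s) :
    f (∑ i, x i • a i) = ∑ i, x i • f (a i) := by
  set p := ∑ i, x i • a i with hp
  have h1 := sq_dist_sum_smul (κ := Unit) hx (y := fun _ => 1) (by simp) a (fun _ => p)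
  have h2 := sq_dist_sum_smul (κ := Unit) hx (y := fun _ => 1) (by simp)
    (fun i => f (a i)) (fun _ => f p)
  simp only [hf _ (ha _) _ (ha _), hf _ (ha _) _ hs, hf _ hs _ hs] at h2
  rw [← h1] at h2
  simp only [Finset.univ_unique, Finset.sum_singleton, one_smul, ← hp, dist_self] at h2
  exact (dist_eq_zero.1 (pow_eq_zero_iff two_ne_zero |>.1 (by simpa using h2))).symm

end WeightedSums

/-! ### Barycentric coordinates on the faces -/

namespace Face

/-- The barycentric coordinate of `p` that belongs to the `i`-th vertex of the face `n`. -/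
noncomputable def bary (n : Face) (i : Fin 3) (p : EuclideanSpace ℝ (Fin 3)) : ℝ :=
  n.sgn i * √2 * p i

theorem pos_vertexAt (n : Face) (i j : Fin 3) :
    (n.vertexAt i).pos j = if i = j then n.sgn i / √2 else 0 := by
  simp only [Vertex.pos, coords_vertexAt]
  split_ifs <;> simp

theorem sgn_mul_self_real (n : Face) (i : Fin 3) : (n.sgn i : ℝ) * n.sgn i = 1 := by
  exact_mod_cast n.sgn_mul_self i

theorem sum_bary_smul (n : Face) (p : EuclideanSpace ℝ (Fin 3)) :
    ∑ i, n.bary i p • (n.vertexAt i).pos = p := by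
  ext j
  simp only [WithLp.ofLp_sum, WithLp.ofLp_smul, Finset.sum_apply, Pi.smul_apply, smul_eq_mul,
    pos_vertexAt, mul_ite, mul_zero, Finset.sum_ite_eq', Finset.mem_univ, if_true, bary]
  have := n.sgn_mul_self_real j
  field_simp
  rw [sq, this, one_mul]

theorem bary_pos_vertexAt (n : Face) (i j : Fin 3) :
    n.bary i (n.vertexAt j).pos = if i = j then 1 else 0 := by
  rw [bary, pos_vertexAt]
  rcases eq_or_ne i j with rfl | h
  · have := n.sgn_mul_self_real i
    simp only [if_true]
    field_simp
    rw [sq, this]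
  · simp [h, h.symm]

theorem bary_flip (n : Face) (k i : Fin 3) (p : EuclideanSpace ℝ (Fin 3)) :
    (n.flip k).bary i p = if i = k then -n.bary i p else n.bary i p := by
  simp only [bary, sgn_flip]
  split_ifs <;> push_cast <;> ring

theorem bary_sum_smul (n : Face) (x : Fin 3 → ℝ) (i : Fin 3) :
    n.bary i (∑ j, x j • (n.vertexAt j).pos) = x i := by
  have : n.bary i (∑ j, x j • (n.vertexAt j).pos) =
      ∑ j, x j * n.bary i (n.vertexAt j).pos := by
    simp only [bary, WithLp.ofLp_sum, WithLp.ofLp_smul, Finset.sum_apply, Pi.smul_apply,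
      smul_eq_mul, Finset.mul_sum]
    exact Finset.sum_congr rfl fun j _ => by ring
  simp [this, bary_pos_vertexAt]

theorem carrier_eq (n : Face) :
    n.carrier = convexHull ℝ (Set.range fun i => (n.vertexAt i).pos) := by
  rw [carrier]
  congr 1
  ext q
  simp only [Set.mem_image, Set.mem_ofPred_eq, mem_verts_iff, Set.mem_range]
  exact ⟨fun ⟨v, ⟨i, hi⟩, hv⟩ => ⟨i, hi ▸ hv⟩, fun ⟨i, hi⟩ => ⟨_, ⟨i, rfl⟩, hi⟩⟩

theorem pos_vertexAt_mem_carrier (n : Face) (i : Fin 3) : (n.vertexAt i).pos ∈ n.carrier := by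
  rw [carrier_eq]
  exact subset_convexHull _ _ ⟨i, rfl⟩

theorem sum_smul_mem_carrier (n : Face) {x : Fin 3 → ℝ} (h0 : ∀ i, 0 ≤ x i)
    (h1 : ∑ i, x i = 1) : ∑ i, x i • (n.vertexAt i).pos ∈ n.carrier := by
  rw [carrier_eq]
  exact (convex_convexHull ℝ _).sum_mem (fun i _ => h0 i) h1
    fun i _ => subset_convexHull _ _ ⟨i, rfl⟩

theorem mem_carrier_iff (n : Face) (p : EuclideanSpace ℝ (Fin 3)) :
    p ∈ n.carrier ↔ (∀ i, 0 ≤ n.bary i p) ∧ ∑ i, n.bary i p = 1 := by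
  constructor
  · intro h
    have hc : Convex ℝ {p | (∀ i, 0 ≤ n.bary i p) ∧ ∑ i, n.bary i p = 1} := by
      intro p hp q hq s t hs ht hst
      have e : ∀ i, n.bary i (s • p + t • q) = s * n.bary i p + t * n.bary i q := fun i => by
        simp only [bary, WithLp.ofLp_add, WithLp.ofLp_smul, Pi.add_apply, Pi.smul_apply,
          smul_eq_mul]
        ring
      refine ⟨fun i => ?_, ?_⟩
      · rw [e]
        exact add_nonneg (mul_nonneg hs (hp.1 i)) (mul_nonneg ht (hq.1 i))
      · simp only [e, Finset.sum_add_distrib, ← Finset.mul_sum, hp.2, hq.2, mul_one, hst]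
    refine convexHull_min ?_ hc (n.carrier_eq ▸ h)
    rintro _ ⟨j, rfl⟩
    refine ⟨fun i => ?_, ?_⟩
    · rw [bary_pos_vertexAt]
      split_ifs <;> norm_num
    · simp [bary_pos_vertexAt]
  · rintro ⟨h0, h1⟩
    rw [← n.sum_bary_smul p]
    exact n.sum_smul_mem_carrier h0 h1

theorem mem_carrier_flip {n : Face} {k : Fin 3} {p : EuclideanSpace ℝ (Fin 3)}
    (hp : p ∈ n.carrier) (hk : n.bary k p = 0) : p ∈ (n.flip k).carrier := by
  rw [mem_carrier_iff] at hp ⊢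
  have e : ∀ i, (n.flip k).bary i p = n.bary i p := fun i => by
    rw [bary_flip]
    split_ifs with h
    · rw [h, hk, neg_zero]
    · rfl
  simpa only [e] using hp

theorem bary_eq_zero {n : Face} {k : Fin 3} {p : EuclideanSpace ℝ (Fin 3)}
    (hp : p ∈ n.carrier) (hk : p ∈ (n.flip k).carrier) : n.bary k p = 0 := by
  have h1 := ((n.mem_carrier_iff p).1 hp).1 k
  have h2 := (((n.flip k).mem_carrier_iff p).1 hk).1 k
  rw [bary_flip, if_pos rfl] at h2
  linarith

theorem dist_pos_vertexAt (n : Face) {i j : Fin 3} (h : i ≠ j) :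
    dist (n.vertexAt i).pos (n.vertexAt j).pos = 1 := by
  rw [EuclideanSpace.dist_eq, Real.sqrt_eq_one, Fin.sum_univ_three]
  simp only [pos_vertexAt, Real.dist_eq, sq_abs]
  have h2 : (√2 : ℝ) ^ 2 = 2 := Real.sq_sqrt (by norm_num)
  have e : ∀ k, ((n.sgn k : ℝ) / √2) ^ 2 = 1 / 2 := fun k => by
    rw [div_pow, h2, sq, sgn_mul_self_real]
  have e' : ∀ k, (-((n.sgn k : ℝ) / √2)) ^ 2 = 1 / 2 := fun k => by rw [neg_sq, e]
  fin_cases i <;> fin_cases j <;> simp only [ne_eq, not_true_eq_false] at h <;>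
    norm_num [e, e', Fin.ext_iff]

/-- The product `(j - i) (k - i) (k - j)` is twice the sign of `(i, j, k)` as a permutation of
`(0, 1, 2)`, and zero if two of the indices agree. -/
theorem two_mul_det_coords (n : Face) (i j k : Fin 3) :
    2 * Matrix.det
        (Matrix.of ![(n.vertexAt i).coords, (n.vertexAt j).coords, (n.vertexAt k).coords]) =
      n.handedness * (((j : ℤ) - i) * ((k : ℤ) - i) * ((k : ℤ) - j)) := by
  rw [Matrix.det_fin_three]
  simp only [Matrix.of_apply, Matrix.cons_val]
  revert n i j k
  decide +kernel

end Face

/-! ### Unfolding across an edge -/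

/-- The vertices of the triangle that arises from the triangle with vertices `P 0`, `P 1`, `P 2`
by a reflection of `P k` in the midpoint of the two other vertices. -/
def reflectAt {M : Type*} [AddCommGroup M] (k : Fin 3) (P : Fin 3 → M) : Fin 3 → M :=
  match k with
  | 0 => ![P 1 + P 2 - P 0, P 1, P 2]
  | 1 => ![P 0, P 0 + P 2 - P 1, P 2]
  | 2 => ![P 0, P 1, P 0 + P 1 - P 2]

/-- The last triangle if `reflectAt` is applied for all letters of a word in turn. -/
def reflectAlong {M : Type*} [AddCommGroup M] (P : Fin 3 → M) : List (Fin 3) → Fin 3 → M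
  | [] => P
  | k :: w => reflectAlong (reflectAt k P) w

theorem reflectAlong_append {M : Type*} [AddCommGroup M] (P : Fin 3 → M) (w w' : List (Fin 3)) :
    reflectAlong P (w ++ w') = reflectAlong (reflectAlong P w) w' := by
  induction w generalizing P with
  | nil => rfl
  | cons k w ih => exact ih _

theorem reflectAt_of_ne {M : Type*} [AddCommGroup M] (P : Fin 3 → M) {k j : Fin 3} (h : j ≠ k) :
    reflectAt k P j = P j := by
  fin_cases k <;> fin_cases j <;> first | rfl | exact absurd rfl h

/-- The three points are the vertices of a triangle with sides of length `1`. -/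
def IsUnitTriangle {E : Type*} [Dist E] (P : Fin 3 → E) : Prop :=
  ∀ i j, i ≠ j → dist (P i) (P j) = 1

section InnerProduct

variable {E : Type*} [NormedAddCommGroup E] [InnerProductSpace ℝ E]

theorem sq_dist_add_sub (q b c o : E) (hb : dist b o = 1) (hc : dist c o = 1)
    (hbc : dist b c = 1) :
    dist q (b + c - o) ^ 2 = dist q b ^ 2 + dist q c ^ 2 - dist q o ^ 2 + 1 := by
  have e1 : q - (b + c - o) = (q - o) - ((b - o) + (c - o)) := by abel
  have e2 : q - b = (q - o) - (b - o) := by abel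
  have e3 : q - c = (q - o) - (c - o) := by abel
  have e4 : b - c = (b - o) - (c - o) := by abel
  rw [dist_eq_norm] at hb hc hbc
  have h := norm_sub_sq_real (b - o) (c - o)
  rw [← e4, hb, hc, hbc] at h
  simp only [dist_eq_norm]
  rw [e1, e2, e3, norm_sub_sq_real, norm_sub_sq_real (q - o) (b - o),
    norm_sub_sq_real (q - o) (c - o), norm_add_sq_real, inner_add_right, hb, hc]
  linarith

theorem sq_dist_reflectAt {P : Fin 3 → E} (hP : IsUnitTriangle P) {q : E} {r : Fin 3 → ℤ}
    (hr : ∀ j, dist q (P j) ^ 2 = r j) (k j : Fin 3) :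
    dist q (reflectAt k P j) ^ 2 = stepRow k r j := by
  have h : ∀ a b c, a ≠ b → a ≠ c → b ≠ c →
      dist q (P a + P b - P c) ^ 2 = ((r a + r b - r c + 1 : ℤ) : ℝ) := fun a b c h1 h2 h3 => by
    rw [sq_dist_add_sub q _ _ _ (hP _ _ h2) (hP _ _ h3) (hP _ _ h1), hr, hr, hr]
    push_cast
    ring
  fin_cases k <;> fin_cases j <;> 
    first | exact hr _ | exact h _ _ _ (by decide) (by decide) (by decide)

theorem IsUnitTriangle.reflectAt {P : Fin 3 → E} (hP : IsUnitTriangle P) (k : Fin 3) :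
    IsUnitTriangle (reflectAt k P) := by
  have h : ∀ a b c, a ≠ b → a ≠ c → b ≠ c → ∀ d, d ≠ c → dist (P d) (P a + P b - P c) = 1 := by
    intro a b c h1 h2 h3 d hd
    rw [← sq_eq_sq₀ dist_nonneg zero_le_one,
      sq_dist_add_sub _ _ _ _ (hP _ _ h2) (hP _ _ h3) (hP _ _ h1), hP _ _ hd]
    have : d = a ∨ d = b := by omega
    rcases this with rfl | rfl
    · rw [dist_self, hP _ _ h1]; norm_num
    · rw [dist_self, hP _ _ h1.symm]; norm_num
  intro i j hij
  fin_cases k <;> fin_cases i <;> fin_cases j <;>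
    first
    | exact absurd rfl hij
    | exact hP _ _ hij
    | exact h _ _ _ (by decide) (by decide) (by decide) _ (by decide)
    | exact (dist_comm _ _).trans (h _ _ _ (by decide) (by decide) (by decide) _ (by decide))

theorem IsUnitTriangle.reflectAlong {P : Fin 3 → E} (hP : IsUnitTriangle P) (w : List (Fin 3)) :
    IsUnitTriangle (reflectAlong P w) := by
  induction w generalizing P with
  | nil => exact hP
  | cons k w ih => exact ih (hP.reflectAt k)

end InnerProduct

/-- Twice the oriented area of a triangle in the plane. -/
noncomputable def orientedArea (P : Fin 3 → EuclideanSpace ℝ (Fin 2)) : ℝ :=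
  (P 1 0 - P 0 0) * (P 2 1 - P 0 1) - (P 1 1 - P 0 1) * (P 2 0 - P 0 0)

theorem orientedArea_reflectAt (k : Fin 3) (P : Fin 3 → EuclideanSpace ℝ (Fin 2)) :
    orientedArea (reflectAt k P) = -orientedArea P := by
  fin_cases k <;> simp [reflectAt, orientedArea] <;> ring

theorem orientedArea_reflectAlong (w : List (Fin 3)) (P : Fin 3 → EuclideanSpace ℝ (Fin 2)) :
    orientedArea (reflectAlong P w) = (-1) ^ w.length * orientedArea P := by
  induction w generalizing P with
  | nil => simp [reflectAlong]
  | cons k w ih => rw [reflectAlong, ih, orientedArea_reflectAt, List.length_cons, pow_succ]; ring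

theorem planeCounterclockwise_iff (P : Fin 3 → EuclideanSpace ℝ (Fin 2)) (i j k : Fin 3) :
    PlaneCounterclockwise (P i) (P j) (P k) ↔
      0 < orientedArea P * (((j : ℤ) - i) * ((k : ℤ) - i) * ((k : ℤ) - j) : ℤ) := by
  have h : 2 * ((P j 0 - P i 0) * (P k 1 - P i 1) - (P j 1 - P i 1) * (P k 0 - P i 0)) =
      orientedArea P * (((j : ℤ) - i) * ((k : ℤ) - i) * ((k : ℤ) - j) : ℤ) := by
    rw [orientedArea]
    fin_cases i <;> fin_cases j <;> fin_cases k <;> simp <;> ring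
  rw [PlaneCounterclockwise, ← h]
  constructor <;> intro h <;> linarith

theorem dist_eq_one_iff (a b : EuclideanSpace ℝ (Fin 2)) :
    dist a b = 1 ↔ (a 0 - b 0) ^ 2 + (a 1 - b 1) ^ 2 = 1 := by
  rw [EuclideanSpace.dist_eq, Real.sqrt_eq_one, Fin.sum_univ_two, Real.dist_eq, Real.dist_eq,
    sq_abs, sq_abs]

/-- There are only two equilateral triangles with a given side, one on each side of it. -/
theorem eq_add_sub_of_dist_eq_one {b c o o' : EuclideanSpace ℝ (Fin 2)} (hbc : dist b c = 1)
    (hb : dist b o = 1) (hc : dist c o = 1) (hb' : dist b o' = 1) (hc' : dist c o' = 1)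
    (h : ((c 0 - b 0) * (o 1 - b 1) - (c 1 - b 1) * (o 0 - b 0)) *
      ((c 0 - b 0) * (o' 1 - b 1) - (c 1 - b 1) * (o' 0 - b 0)) < 0) : o' = b + c - o := by
  rw [dist_eq_one_iff] at hbc hb hc hb' hc'
  -- The scalar products of `o - b` and `o' - b` with `c - b` agree, and the oriented areas `A`, `B`
  -- have the same square, so they are opposite; this determines `o + o'`.
  set A := (c 0 - b 0) * (o 1 - b 1) - (c 1 - b 1) * (o 0 - b 0) with hA
  set B := (c 0 - b 0) * (o' 1 - b 1) - (c 1 - b 1) * (o' 0 - b 0) with hB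
  have d : (c 0 - b 0) * (o 0 - b 0) + (c 1 - b 1) * (o 1 - b 1) = 1 / 2 := by
    linear_combination (hb + hbc - hc) / 2
  have d' : (c 0 - b 0) * (o' 0 - b 0) + (c 1 - b 1) * (o' 1 - b 1) = 1 / 2 := by
    linear_combination (hb' + hbc - hc') / 2
  have hA2 : A ^ 2 = 3 / 4 := by
    linear_combination (exp := 1) hbc * ((b 0 - o 0) ^ 2 + (b 1 - o 1) ^ 2) + hb -
      (((c 0 - b 0) * (o 0 - b 0) + (c 1 - b 1) * (o 1 - b 1)) + 1 / 2) * d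
  have hB2 : B ^ 2 = 3 / 4 := by
    linear_combination (exp := 1) hbc * ((b 0 - o' 0) ^ 2 + (b 1 - o' 1) ^ 2) + hb' -
      (((c 0 - b 0) * (o' 0 - b 0) + (c 1 - b 1) * (o' 1 - b 1)) + 1 / 2) * d'
  have hAB : A + B = 0 := by
    have h1 : (A + B) * (A - B) = 0 := by linear_combination hA2 - hB2
    rcases mul_eq_zero.1 h1 with h2 | h2
    · exact h2
    · rw [sub_eq_zero.1 h2] at h
      exact absurd h (not_lt.2 (mul_self_nonneg _))
  have h0 : o' 0 + o 0 - b 0 - c 0 = 0 := by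
    linear_combination (c 0 - b 0) * (d + d') - (c 1 - b 1) * hAB
      - (o' 0 + o 0 - b 0 - c 0 + (c 0 - b 0)) * hbc
  have h1 : o' 1 + o 1 - b 1 - c 1 = 0 := by
    linear_combination (c 1 - b 1) * (d + d') + (c 0 - b 0) * hAB
      - (o' 1 + o 1 - b 1 - c 1 + (c 1 - b 1)) * hbc
  ext i
  fin_cases i
  · simp; linarith
  · simp; linarith

theorem eq_reflectAt {P Q : Fin 3 → EuclideanSpace ℝ (Fin 2)} (hP : IsUnitTriangle P)
    (hQ : IsUnitTriangle Q) {k : Fin 3} (h : ∀ j, j ≠ k → Q j = P j)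
    (ho : orientedArea P * orientedArea Q < 0) : Q = reflectAt k P := by
  have key : ∀ b c, b ≠ c → b ≠ k → c ≠ k →
      ((P c 0 - P b 0) * (P k 1 - P b 1) - (P c 1 - P b 1) * (P k 0 - P b 0)) *
      ((P c 0 - P b 0) * (Q k 1 - P b 1) - (P c 1 - P b 1) * (Q k 0 - P b 0)) < 0 →
      Q k = P b + P c - P k := fun b c hbc hb hc ho => by
    refine eq_add_sub_of_dist_eq_one (hP _ _ hbc) (hP _ _ hb) (hP _ _ hc) ?_ ?_ ho
    · rw [← h b hb]; exact hQ _ _ hb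
    · rw [← h c hc]; exact hQ _ _ hc
  have e : ∀ j, j ≠ k → Q j = reflectAt k P j := fun j hj => by
    rw [h j hj, reflectAt_of_ne P hj]
  funext j
  rcases eq_or_ne j k with rfl | hj
  · simp only [orientedArea] at ho
    fin_cases j
    · have h1 := h 1 (by decide)
      have h2 := h 2 (by decide)
      rw [h1, h2] at ho
      refine key 1 2 (by decide) (by decide) (by decide) (lt_of_eq_of_lt ?_ ho)
      simp only [Fin.zero_eta, Fin.isValue]; ring
    · have h1 := h 0 (by decide)
      have h2 := h 2 (by decide)
      rw [h1, h2] at ho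
      refine key 0 2 (by decide) (by decide) (by decide) (lt_of_eq_of_lt ?_ ho)
      simp only [Fin.mk_one, Fin.isValue]; ring
    · have h1 := h 0 (by decide)
      have h2 := h 1 (by decide)
      rw [h1, h2] at ho
      refine key 0 1 (by decide) (by decide) (by decide) (lt_of_eq_of_lt ?_ ho)
      simp only [Fin.reduceFinMk, Fin.isValue]
  · exact e j hj

/-! ### Unfoldings along a word -/

/-- The vertices of the unfolded face `n`, numbered by their axes. -/
noncomputable def placed (g : Face → EuclideanSpace ℝ (Fin 3) → EuclideanSpace ℝ (Fin 2))
    (n : Face) : Fin 3 → EuclideanSpace ℝ (Fin 2) :=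
  fun j => g n (n.vertexAt j).pos

/-- The walk from `n` with word `w` stays inside the subgraph `H`. -/
def HasWalk (H : Face.adjGraph.Subgraph) : Face → List (Fin 3) → Prop
  | n, [] => n ∈ H.verts
  | n, k :: w => H.Adj n (n.flip k) ∧ HasWalk H (n.flip k) w

namespace HasWalk

variable {H : Face.adjGraph.Subgraph}

theorem mem_verts {n : Face} {w : List (Fin 3)} (h : HasWalk H n w) : n ∈ H.verts := by
  cases w with
  | nil => exact h
  | cons k w => exact H.edge_vert h.1

theorem append_iff {n : Face} {w w' : List (Fin 3)} :
    HasWalk H n (w ++ w') ↔ HasWalk H n w ∧ HasWalk H (n.flips w) w' := by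
  induction w generalizing n with
  | nil => exact ⟨fun h => ⟨h.mem_verts, h⟩, fun h => h.2⟩
  | cons k w ih =>
    simp only [List.cons_append, HasWalk, Face.flips, ih, and_assoc]

theorem flips_mem_verts {n : Face} {w : List (Fin 3)} (h : HasWalk H n w) :
    n.flips w ∈ H.verts := by
  rw [← List.append_nil w, append_iff] at h
  exact h.2

theorem mono {H' : Face.adjGraph.Subgraph} (hH : H ≤ H') {n : Face} {w : List (Fin 3)}
    (h : HasWalk H n w) : HasWalk H' n w := by
  induction w generalizing n with
  | nil => exact hH.1 h
  | cons k w ih => exact ⟨hH.2 h.1, ih h.2⟩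

end HasWalk

/-- In a connected subgraph, any two faces are joined by the walk of some word that does not visit a
face twice. -/
theorem exists_hasWalk {H : Face.adjGraph.Subgraph} (hH : H.Connected) {n m : Face}
    (hn : n ∈ H.verts) (hm : m ∈ H.verts) :
    ∃ w, HasWalk H n w ∧ n.flips w = m ∧ (n.trail w).Nodup := by
  obtain ⟨p, hp⟩ := (hH.coe.preconnected ⟨n, hn⟩ ⟨m, hm⟩).exists_isPath
  have key : ∀ {x y : H.verts} (p : H.coe.Walk x y),
      ∃ w, HasWalk H x w ∧ (x : Face).flips w = y ∧
        (x : Face).trail w = p.support.map Subtype.val := by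
    intro x y p
    induction p with
    | nil => exact ⟨[], Subtype.property _, rfl, rfl⟩
    | @cons x y z h p ih =>
      obtain ⟨w, h1, h2, h3⟩ := ih
      obtain ⟨k, hk⟩ := (Face.adj_iff x y).1 (H.adj_sub h)
      refine ⟨k :: w, ⟨hk ▸ h, hk ▸ h1⟩, ?_, ?_⟩
      · rw [Face.flips, ← hk, h2]
      · rw [Face.trail, ← hk, h3, SimpleGraph.Walk.support_cons, List.map_cons]
  obtain ⟨w, h1, h2, h3⟩ := key p
  exact ⟨w, h1, h2, h3 ▸ hp.support_nodup.map Subtype.val_injective⟩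

namespace Face

/-- The walk from `n` with word `w`, in the graph of all faces. -/
def wordWalk : (n : Face) → (w : List (Fin 3)) → adjGraph.Walk n (n.flips w)
  | _, [] => .nil
  | n, k :: w => .cons (n.adj_flip k) ((n.flip k).wordWalk w)

theorem support_wordWalk (n : Face) (w : List (Fin 3)) : (n.wordWalk w).support = n.trail w := by
  induction w generalizing n with
  | nil => rfl
  | cons k w ih => exact congrArg (n :: ·) (ih _)

theorem hasWalk_toSubgraph (n : Face) (w : List (Fin 3)) :
    HasWalk (n.wordWalk w).toSubgraph n w := by
  induction w generalizing n with
  | nil => exact SimpleGraph.Walk.start_mem_verts_toSubgraph _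
  | cons k w ih =>
    refine ⟨?_, (ih _).mono le_sup_right⟩
    change (adjGraph.subgraphOfAdj (n.adj_flip k) ⊔ ((n.flip k).wordWalk w).toSubgraph).Adj _ _
    exact SimpleGraph.Subgraph.sup_adj.2 (Or.inl rfl)

theorem toSubgraph_wordWalk_le {H : adjGraph.Subgraph} {n : Face} {w : List (Fin 3)}
    (h : HasWalk H n w) : (n.wordWalk w).toSubgraph ≤ H := by
  induction w generalizing n with
  | nil => exact (SimpleGraph.singletonSubgraph_le_iff _ _).2 h
  | cons k w ih =>
    exact sup_le (SimpleGraph.subgraphOfAdj_le_of_adj _ h.1) (ih h.2)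

end Face

namespace IsUnfolding

variable {H : Face.adjGraph.Subgraph}
  {g : Face → EuclideanSpace ℝ (Fin 3) → EuclideanSpace ℝ (Fin 2)}

theorem mono {H' : Face.adjGraph.Subgraph} (hg : IsUnfolding H g) (h : H' ≤ H) :
    IsUnfolding H' g where
  isometric n hn := hg.isometric n (h.1 hn)
  exterior_up n hn := hg.exterior_up n (h.1 hn)
  glued n m hnm := hg.glued n m (h.2 hnm)

theorem apply_eq (hg : IsUnfolding H g) {n : Face} (hn : n ∈ H.verts)
    {p : EuclideanSpace ℝ (Fin 3)} (hp : p ∈ n.carrier) :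
    g n p = ∑ i, n.bary i p • placed g n i := by
  have h := map_sum_smul_of_dist_eq (hg.isometric n hn) ((n.mem_carrier_iff p).1 hp).2
    n.pos_vertexAt_mem_carrier (by rwa [n.sum_bary_smul])
  rwa [n.sum_bary_smul] at h

theorem isUnitTriangle (hg : IsUnfolding H g) {n : Face} (hn : n ∈ H.verts) :
    IsUnitTriangle (placed g n) := fun i j hij => by
  rw [placed, placed, hg.isometric n hn _ (n.pos_vertexAt_mem_carrier i) _
    (n.pos_vertexAt_mem_carrier j), n.dist_pos_vertexAt hij]

theorem orientedArea_mul_handedness_pos (hg : IsUnfolding H g) {n : Face} (hn : n ∈ H.verts) :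
    0 < orientedArea (placed g n) * n.handedness := by
  have h : ∀ i j k, (n.vertexAt i).Counterclockwise (n.vertexAt j) (n.vertexAt k) →
      PlaneCounterclockwise (placed g n i) (placed g n j) (placed g n k) := fun i j k =>
    hg.exterior_up n hn _ ((n.mem_verts_iff _).2 ⟨i, rfl⟩) _ ((n.mem_verts_iff _).2 ⟨j, rfl⟩)
      _ ((n.mem_verts_iff _).2 ⟨k, rfl⟩)
  simp only [planeCounterclockwise_iff, Vertex.Counterclockwise] at h
  rcases n.handedness_eq with e | e
  · have := h 0 1 2 (by have := n.two_mul_det_coords 0 1 2; rw [e] at this; simp at this; omega)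
    rw [e]
    norm_num at this ⊢
    exact this
  · have := h 0 2 1 (by have := n.two_mul_det_coords 0 2 1; rw [e] at this; simp at this; omega)
    rw [e]
    norm_num at this ⊢
    linarith

theorem placed_flip (hg : IsUnfolding H g) {n : Face} {k : Fin 3} (h : H.Adj n (n.flip k)) :
    placed g (n.flip k) = reflectAt k (placed g n) := by
  have h1 := H.edge_vert h
  have h2 := H.edge_vert h.symm
  refine eq_reflectAt (hg.isUnitTriangle h1) (hg.isUnitTriangle h2) (fun j hj => ?_) ?_
  · rw [placed, placed, n.vertexAt_flip_of_ne hj]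
    refine (hg.glued _ _ h _ ?_).symm
    have := (n.flip k).pos_vertexAt_mem_carrier j
    rw [n.vertexAt_flip_of_ne hj] at this
    exact ⟨n.pos_vertexAt_mem_carrier j, this⟩
  · have a1 := hg.orientedArea_mul_handedness_pos h1
    have a2 := hg.orientedArea_mul_handedness_pos h2
    rw [n.handedness_flip] at a2
    have e : (n.handedness : ℝ) * n.handedness = 1 := by
      rcases n.handedness_eq with e | e <;> rw [e] <;> norm_num
    have := mul_pos a1 a2
    push_cast at this
    nlinarith

theorem sq_dist_placed (hg : IsUnfolding H g) {n : Face} {w : List (Fin 3)} (h : HasWalk H n w)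
    {q : EuclideanSpace ℝ (Fin 2)} {r : Fin 3 → ℤ} (hr : ∀ j, dist q (placed g n j) ^ 2 = r j)
    (j : Fin 3) : dist q (placed g (n.flips w) j) ^ 2 = distRow r w j := by
  induction w generalizing n r with
  | nil => exact hr j
  | cons k w ih =>
    refine ih h.2 fun j => ?_
    rw [hg.placed_flip h.1, sq_dist_reflectAt (hg.isUnitTriangle (H.edge_vert h.1)) hr]

theorem sq_dist_placed_placed (hg : IsUnfolding H g) {n : Face} {w : List (Fin 3)}
    (h : HasWalk H n w) (i j : Fin 3) :
    dist (placed g n i) (placed g (n.flips w) j) ^ 2 = sqDist w i j := by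
  refine hg.sq_dist_placed h (fun j => ?_) j
  split_ifs with hij
  · rw [hij, dist_self]; norm_num
  · rw [hg.isUnitTriangle h.mem_verts _ _ hij]; norm_num

/-- The distance between the places of two points depends on the word of a walk between their faces
only, and its square is bilinear in the barycentric coordinates, up to terms that do not even depend
on the word. -/
theorem sq_dist_eq (hg : IsUnfolding H g) {n : Face} {w : List (Fin 3)} (h : HasWalk H n w)
    {p₁ p₂ : EuclideanSpace ℝ (Fin 3)} (h₁ : p₁ ∈ n.carrier) (h₂ : p₂ ∈ (n.flips w).carrier) :
    dist (g n p₁) (g (n.flips w) p₂) ^ 2 =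
      ∑ i, ∑ j, n.bary i p₁ * (n.flips w).bary j p₂ * sqDist w i j -
        (∑ i, ∑ j, n.bary i p₁ * n.bary j p₁ * sqDist [] i j) / 2 -
        (∑ i, ∑ j, (n.flips w).bary i p₂ * (n.flips w).bary j p₂ * sqDist [] i j) / 2 := by
  have h' := h.flips_mem_verts
  rw [hg.apply_eq h.mem_verts h₁, hg.apply_eq h' h₂,
    sq_dist_sum_smul ((n.mem_carrier_iff _).1 h₁).2 (((n.flips w).mem_carrier_iff _).1 h₂).2]
  have e : ∀ {x : Face}, x ∈ H.verts → ∀ i j,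
      dist (placed g x i) (placed g x j) ^ 2 = sqDist [] i j := fun hx =>
    hg.sq_dist_placed_placed (w := []) hx
  simp only [hg.sq_dist_placed_placed h, e h.mem_verts, e h']

/-- The distance between the places of two points is the same for any two unfoldings. -/
theorem dist_eq_dist (hg : IsUnfolding H g) {H' : Face.adjGraph.Subgraph}
    {g' : Face → EuclideanSpace ℝ (Fin 3) → EuclideanSpace ℝ (Fin 2)} (hg' : IsUnfolding H' g')
    {n : Face} {w : List (Fin 3)} (h : HasWalk H n w) (h' : HasWalk H' n w)
    {p₁ p₂ : EuclideanSpace ℝ (Fin 3)} (h₁ : p₁ ∈ n.carrier) (h₂ : p₂ ∈ (n.flips w).carrier) :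
    dist (g n p₁) (g (n.flips w) p₂) = dist (g' n p₁) (g' (n.flips w) p₂) := by
  rw [← sq_eq_sq₀ dist_nonneg dist_nonneg, hg.sq_dist_eq h h₁ h₂, hg'.sq_dist_eq h' h₁ h₂]

/-- If the end points are not in the second and the last but one face, respectively, then a shortcut
makes their distance smaller. -/
theorem dist_lt_of_isShortcut (hg : IsUnfolding H g) {H' : Face.adjGraph.Subgraph}
    {g' : Face → EuclideanSpace ℝ (Fin 3) → EuclideanSpace ℝ (Fin 2)} (hg' : IsUnfolding H' g')
    {n : Face} {w w' : List (Fin 3)} (h : HasWalk H n w) (h' : HasWalk H' n w')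
    (hw : IsShortcut w w') {p₁ p₂ : EuclideanSpace ℝ (Fin 3)} (h₁ : p₁ ∈ n.carrier)
    (h₂ : p₂ ∈ (n.flips w).carrier) (k₁ : n.bary (w.headD 0) p₁ ≠ 0)
    (k₂ : (n.flips w).bary (w.getLastD 0) p₂ ≠ 0) :
    dist (g' n p₁) (g' (n.flips w') p₂) < dist (g n p₁) (g (n.flips w) p₂) := by
  have e := Face.flips_eq_of_F1 hw.1 n
  have b₁ := ((n.mem_carrier_iff _).1 h₁).1
  have b₂ := (((n.flips w).mem_carrier_iff _).1 h₂).1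
  rw [← sq_lt_sq₀ dist_nonneg dist_nonneg, hg.sq_dist_eq h h₁ h₂,
    hg'.sq_dist_eq h' h₁ (e ▸ h₂), ← e]
  refine sub_lt_sub_right (sub_lt_sub_right ?_ _) _
  have le : ∀ i j, n.bary i p₁ * (n.flips w).bary j p₂ * sqDist w' i j ≤
      n.bary i p₁ * (n.flips w).bary j p₂ * sqDist w i j := fun i j =>
    mul_le_mul_of_nonneg_left (by exact_mod_cast hw.2.1 i j) (mul_nonneg (b₁ i) (b₂ j))
  refine Finset.sum_lt_sum (fun i _ => Finset.sum_le_sum fun j _ => le i j)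
    ⟨w.headD 0, Finset.mem_univ _, Finset.sum_lt_sum (fun j _ => le _ j)
      ⟨w.getLastD 0, Finset.mem_univ _, ?_⟩⟩
  exact mul_lt_mul_of_pos_left (by exact_mod_cast hw.2.2)
    (mul_pos ((b₁ _).lt_of_ne' k₁) ((b₂ _).lt_of_ne' k₂))

end IsUnfolding

/-! ### Unfolded strips are convex -/

theorem sum_eq_of_ne {M : Type*} [AddCommMonoid M] (f : Fin 3 → M) {a b c : Fin 3} (hab : a ≠ b)
    (hac : a ≠ c) (hbc : b ≠ c) : ∑ i, f i = f a + f b + f c := by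
  have : (Finset.univ : Finset (Fin 3)) = {a, b, c} := by
    revert a b c; decide
  rw [this, Finset.sum_insert (by simp [hab, hac]), Finset.sum_pair hbc, add_assoc]

theorem reflectAt_self {M : Type*} [AddCommGroup M] (P : Fin 3 → M) {a b c : Fin 3} (hab : a ≠ b)
    (hac : a ≠ c) (hbc : b ≠ c) : reflectAt a P a = P b + P c - P a := by
  fin_cases a <;> fin_cases b <;> fin_cases c <;>
    first | exact absurd rfl hab | exact absurd rfl hac | exact absurd rfl hbc | rfl |
      exact congrArg (· - _) (add_comm _ _)

theorem exists_straight : ∀ w ∈ straightWords, ∃ a b c : Fin 3, a ≠ b ∧ a ≠ c ∧ b ≠ c ∧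
    (w = [a] ∨ w = [a, b] ∨ w = [a, b, c]) := by
  decide

/-- The point with coordinates `s`, `t` with respect to the origin `P a` and the unit vectors
`P c - P a` and `P b - P a`. -/
noncomputable def stripPoint (P : Fin 3 → EuclideanSpace ℝ (Fin 2)) (a b c : Fin 3) (s t : ℝ) :
    EuclideanSpace ℝ (Fin 2) :=
  P a + s • (P c - P a) + t • (P b - P a)

theorem segment_stripPoint_subset {P : Fin 3 → EuclideanSpace ℝ (Fin 2)} {a b c : Fin 3}
    {C : Set (ℝ × ℝ)} (hC : Convex ℝ C) {R : Set (EuclideanSpace ℝ (Fin 2))}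
    (hR : ∀ s t, (s, t) ∈ C → stripPoint P a b c s t ∈ R) {s t s' t' : ℝ} (h : (s, t) ∈ C)
    (h' : (s', t') ∈ C) :
    segment ℝ (stripPoint P a b c s t) (stripPoint P a b c s' t') ⊆ R := by
  rintro _ ⟨x, y, hx, hy, hxy, rfl⟩
  have := hR _ _ (hC h h' hx hy hxy)
  convert this using 1
  have hy' : y = 1 - x := by linarith
  simp only [stripPoint, Prod.smul_mk, smul_eq_mul, hy']
  module

namespace IsUnfolding

variable {H : Face.adjGraph.Subgraph}
  {g : Face → EuclideanSpace ℝ (Fin 3) → EuclideanSpace ℝ (Fin 2)}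

theorem sum_smul_placed_mem (hg : IsUnfolding H g) {n : Face} (hn : n ∈ H.verts) {x : Fin 3 → ℝ}
    (h0 : ∀ i, 0 ≤ x i) (h1 : ∑ i, x i = 1) :
    ∑ i, x i • placed g n i ∈ g n '' n.carrier := by
  have h := n.sum_smul_mem_carrier h0 h1
  refine ⟨_, h, ?_⟩
  rw [hg.apply_eq hn h]
  simp only [n.bary_sum_smul]

theorem smul_placed_mem (hg : IsUnfolding H g) {n : Face} (hn : n ∈ H.verts) {a b c : Fin 3}
    (hab : a ≠ b) (hac : a ≠ c) (hbc : b ≠ c) {x y z : ℝ} (hx : 0 ≤ x) (hy : 0 ≤ y) (hz : 0 ≤ z)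
    (h1 : x + y + z = 1) :
    x • placed g n a + y • placed g n b + z • placed g n c ∈
      ⋃ m ∈ H.verts, g m '' m.carrier := by
  let f : Fin 3 → ℝ := fun i => if i = a then x else if i = b then y else z
  have fa : f a = x := if_pos rfl
  have fb : f b = y := by simp [f, hab.symm]
  have fc : f c = z := by simp [f, hac.symm, hbc.symm]
  have h := hg.sum_smul_placed_mem hn (x := f) (fun i => by
    simp only [f]; split_ifs <;> assumption)
    (by rw [sum_eq_of_ne f hab hac hbc, fa, fb, fc, h1])
  rw [sum_eq_of_ne _ hab hac hbc, fa, fb, fc] at h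
  exact Set.mem_biUnion hn h

variable {n : Face} {a b c : Fin 3}

theorem apply_eq_stripPoint (hg : IsUnfolding H g) (hn : n ∈ H.verts) (hab : a ≠ b) (hac : a ≠ c)
    (hbc : b ≠ c) {p : EuclideanSpace ℝ (Fin 3)} (hp : p ∈ n.carrier) :
    g n p = stripPoint (placed g n) a b c (n.bary c p) (n.bary b p) := by
  have h1 := ((n.mem_carrier_iff p).1 hp).2
  rw [sum_eq_of_ne _ hab hac hbc] at h1
  have : n.bary a p = 1 - n.bary b p - n.bary c p := by linarith
  rw [hg.apply_eq hn hp, sum_eq_of_ne _ hab hac hbc, stripPoint, this]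
  module

theorem stripPoint_mem_one (hg : IsUnfolding H g) (h : HasWalk H n [a]) (hab : a ≠ b) (hac : a ≠ c)
    (hbc : b ≠ c) {s t : ℝ} (hs : 0 ≤ s) (ht : 0 ≤ t) (hs' : s ≤ 1) (ht' : t ≤ 1) :
    stripPoint (placed g n) a b c s t ∈ ⋃ m ∈ H.verts, g m '' m.carrier := by
  rcases le_total (s + t) 1 with hst | hst
  · convert hg.smul_placed_mem h.mem_verts hab hac hbc (x := 1 - s - t) (y := t) (z := s)
      (by linarith) ht hs (by ring) using 1
    rw [stripPoint]
    module
  · convert hg.smul_placed_mem h.2 hab hac hbc (x := s + t - 1) (y := 1 - s) (z := 1 - t)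
      (by linarith) (by linarith) (by linarith) (by ring) using 1
    rw [hg.placed_flip h.1, reflectAt_self _ hab hac hbc, reflectAt_of_ne _ hab.symm,
      reflectAt_of_ne _ hac.symm, stripPoint]
    module

theorem stripPoint_mem_two (hg : IsUnfolding H g) (h : HasWalk H n [a, b]) (hab : a ≠ b)
    (hac : a ≠ c) (hbc : b ≠ c) {s t : ℝ} (hs : 0 ≤ s) (ht : 0 ≤ t) (hst : s + t ≤ 2)
    (ht' : t ≤ 1) :
    stripPoint (placed g n) a b c s t ∈ ⋃ m ∈ H.verts, g m '' m.carrier := by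
  rcases le_total s 1 with hs' | hs'
  · exact hg.stripPoint_mem_one (HasWalk.append_iff (w := [a]) (w' := [b]).1 h).1 hab hac hbc
      hs ht hs' ht'
  · convert hg.smul_placed_mem h.2.2 hab hac hbc (x := t) (y := s - 1) (z := 2 - s - t)
      ht (by linarith) (by linarith) (by ring) using 1
    rw [hg.placed_flip h.2.1, hg.placed_flip h.1, reflectAt_of_ne _ hab,
      reflectAt_self _ hab.symm hbc hac, reflectAt_of_ne _ hbc.symm,
      reflectAt_self _ hab hac hbc, reflectAt_of_ne _ hac.symm, reflectAt_of_ne _ hab.symm,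
      stripPoint]
    module

theorem stripPoint_mem_three (hg : IsUnfolding H g) (h : HasWalk H n [a, b, c]) (hab : a ≠ b)
    (hac : a ≠ c) (hbc : b ≠ c) {s t : ℝ} (hs : 0 ≤ s) (ht : 0 ≤ t) (hs' : s ≤ 2) (ht' : t ≤ 1) :
    stripPoint (placed g n) a b c s t ∈ ⋃ m ∈ H.verts, g m '' m.carrier := by
  rcases le_total (s + t) 2 with hst | hst
  · exact hg.stripPoint_mem_two (HasWalk.append_iff (w := [a, b]) (w' := [c]).1 h).1 hab hac hbc
      hs ht hst ht'
  · convert hg.smul_placed_mem h.2.2.2 hab hac hbc (x := 2 - s) (y := 1 - t) (z := s + t - 2)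
      (by linarith) (by linarith) (by linarith) (by ring) using 1
    rw [hg.placed_flip h.2.2.1, hg.placed_flip h.2.1, hg.placed_flip h.1,
      reflectAt_self _ hac.symm hbc.symm hab, reflectAt_of_ne _ hac, reflectAt_of_ne _ hab,
      reflectAt_of_ne _ hbc, reflectAt_self _ hab.symm hbc hac, reflectAt_of_ne _ hbc.symm,
      reflectAt_self _ hab hac hbc, reflectAt_of_ne _ hac.symm, reflectAt_of_ne _ hab.symm,
      stripPoint]
    module

/-- The unfolded faces on the walk of a word without repeated letters form a convex region, so that
it contains all segments between the first and the last one of them. -/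
theorem segment_subset (hg : IsUnfolding H g) {w : List (Fin 3)} (h : HasWalk H n w)
    (hw : w ∈ straightWords) {p₁ p₂ : EuclideanSpace ℝ (Fin 3)} (h₁ : p₁ ∈ n.carrier)
    (h₂ : p₂ ∈ (n.flips w).carrier) :
    segment ℝ (g n p₁) (g (n.flips w) p₂) ⊆ ⋃ m ∈ H.verts, g m '' m.carrier := by
  obtain ⟨a, b, c, hab, hac, hbc, hw⟩ := exists_straight w hw
  have hn := h.mem_verts
  rw [hg.apply_eq_stripPoint hn hab hac hbc h₁]
  obtain ⟨x0, x1⟩ := (n.mem_carrier_iff p₁).1 h₁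
  obtain ⟨y0, y1⟩ := ((n.flips w).mem_carrier_iff p₂).1 h₂
  rw [sum_eq_of_ne _ hab hac hbc] at x1 y1
  have xa := x0 a
  have xb := x0 b
  have xc := x0 c
  have ya := y0 a
  have yb := y0 b
  have yc := y0 c
  rw [hg.apply_eq h.flips_mem_verts h₂, sum_eq_of_ne _ hab hac hbc]
  generalize (n.flips w).bary a p₂ = α at *
  generalize (n.flips w).bary b p₂ = β at *
  generalize (n.flips w).bary c p₂ = γ at *
  obtain rfl : α = 1 - β - γ := by linarith
  have convex_strip : ∀ u v d : ℝ,
      Convex ℝ {z : ℝ × ℝ | 0 ≤ z.1 ∧ 0 ≤ z.2 ∧ u * z.1 + v * z.2 ≤ d ∧ z.2 ≤ 1} := by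
    rintro u v d ⟨s, t⟩ ⟨z1, z2, z3, z4⟩ ⟨s', t'⟩ ⟨z1', z2', z3', z4'⟩ x y hx hy hxy
    simp only at z1 z2 z3 z4 z1' z2' z3' z4'
    simp only [Set.mem_ofPred_eq, Prod.smul_mk, Prod.mk_add_mk, smul_eq_mul]
    refine ⟨by positivity, by positivity, ?_, ?_⟩
    · have e1 := mul_le_mul_of_nonneg_left z3 hx
      have e2 := mul_le_mul_of_nonneg_left z3' hy
      have e3 : x * d + y * d = d := by rw [← add_mul, hxy, one_mul]
      linarith
    · have e1 := mul_le_mul_of_nonneg_left z4 hx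
      have e2 := mul_le_mul_of_nonneg_left z4' hy
      linarith
  rcases hw with rfl | rfl | rfl
  · have e : (1 - β - γ) • placed g (n.flips [a]) a + β • placed g (n.flips [a]) b +
        γ • placed g (n.flips [a]) c = stripPoint (placed g n) a b c (1 - β) (1 - γ) := by
      simp only [Face.flips]
      rw [hg.placed_flip h.1, reflectAt_self _ hab hac hbc, reflectAt_of_ne _ hab.symm,
        reflectAt_of_ne _ hac.symm, stripPoint]
      module
    rw [e]
    refine segment_stripPoint_subset (convex_strip 1 0 1) (fun s t hst =>
      hg.stripPoint_mem_one h hab hac hbc hst.1 hst.2.1 ?_ hst.2.2.2) ?_ ?_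
    · linarith [hst.2.2.1]
    · exact ⟨xc, xb, by linarith, by linarith⟩
    · exact ⟨by linarith, by linarith, by linarith, by linarith⟩
  · have e : (1 - β - γ) • placed g (n.flips [a, b]) a + β • placed g (n.flips [a, b]) b +
        γ • placed g (n.flips [a, b]) c =
          stripPoint (placed g n) a b c (1 + β) (1 - β - γ) := by
      simp only [Face.flips]
      rw [hg.placed_flip h.2.1, hg.placed_flip h.1, reflectAt_of_ne _ hab,
        reflectAt_self _ hab.symm hbc hac, reflectAt_of_ne _ hbc.symm,
        reflectAt_self _ hab hac hbc, reflectAt_of_ne _ hac.symm, reflectAt_of_ne _ hab.symm,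
        stripPoint]
      module
    rw [e]
    refine segment_stripPoint_subset (convex_strip 1 1 2) (fun s t hst =>
      hg.stripPoint_mem_two h hab hac hbc hst.1 hst.2.1 ?_ hst.2.2.2) ?_ ?_
    · linarith [hst.2.2.1]
    · exact ⟨xc, xb, by linarith, by linarith⟩
    · exact ⟨by linarith, by linarith, by linarith, by linarith⟩
  · have e : (1 - β - γ) • placed g (n.flips [a, b, c]) a + β • placed g (n.flips [a, b, c]) b +
        γ • placed g (n.flips [a, b, c]) c =
          stripPoint (placed g n) a b c (1 + β + γ) (1 - β) := by
      simp only [Face.flips]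
      rw [hg.placed_flip h.2.2.1, hg.placed_flip h.2.1, hg.placed_flip h.1,
        reflectAt_self _ hac.symm hbc.symm hab, reflectAt_of_ne _ hac, reflectAt_of_ne _ hab,
        reflectAt_of_ne _ hbc, reflectAt_self _ hab.symm hbc hac, reflectAt_of_ne _ hbc.symm,
        reflectAt_self _ hab hac hbc, reflectAt_of_ne _ hac.symm, reflectAt_of_ne _ hab.symm,
        stripPoint]
      module
    rw [e]
    refine segment_stripPoint_subset (convex_strip 1 0 2) (fun s t hst =>
      hg.stripPoint_mem_three h hab hac hbc hst.1 hst.2.1 ?_ hst.2.2.2) ?_ ?_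
    · linarith [hst.2.2.1]
    · exact ⟨xc, xb, by linarith, by linarith⟩
    · exact ⟨by linarith, by linarith, by linarith, by linarith⟩

end IsUnfolding

/-! ### A net for every word without repeated letters -/

/-- The walk from `n` to the face `x` in a certain net: a strip of six faces, along the walk of
`a`, `b`, `c`, `a`, `b`, and the two remaining faces attached to the first two faces of it. -/
def netWord (n : Face) (a b c : Fin 3) (x : Face) : List (Fin 3) :=
  match decide (n.sgn a = x.sgn a), decide (n.sgn b = x.sgn b), decide (n.sgn c = x.sgn c) with
  | true, true, true => []
  | false, true, true => [a]
  | false, false, true => [a, b]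
  | false, false, false => [a, b, c]
  | true, false, false => [a, b, c, a]
  | true, true, false => [a, b, c, a, b]
  | true, false, true => [b]
  | false, true, false => [a, c]

theorem flips_netWord : ∀ (n : Face) {a b c : Fin 3}, a ≠ b → a ≠ c → b ≠ c → ∀ x : Face,
    n.flips (netWord n a b c x) = x := by
  decide +kernel

theorem netWord_dropLast : ∀ (n : Face) {a b c : Fin 3}, a ≠ b → a ≠ c → b ≠ c → ∀ x : Face,
    netWord n a b c (n.flips (netWord n a b c x).dropLast) = (netWord n a b c x).dropLast := by
  decide +kernel

theorem netWord_flips : ∀ (n : Face) {a b c : Fin 3}, a ≠ b → a ≠ c → b ≠ c →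
    netWord n a b c n = [] ∧ netWord n a b c (n.flips [a]) = [a] ∧
      netWord n a b c (n.flips [a, b]) = [a, b] ∧
      netWord n a b c (n.flips [a, b, c]) = [a, b, c] := by
  decide +kernel

/-- The vertices of a unit triangle, in coordinates with respect to a basis of the triangular
lattice. -/
def latticeTriangle : Fin 3 → ℤ × ℤ := ![(0, 0), (1, 0), (0, 1)]

/-- Any two faces of the net lie on different sides of a lattice line, given by a functional with
coefficients `d`. -/
theorem netWord_separated : ∀ (n : Face) {a b c : Fin 3}, a ≠ b → a ≠ c → b ≠ c →
    ∀ x y : Face, x ≠ y → ∃ d ∈ [((1 : ℤ), (0 : ℤ)), (0, 1), (1, 1), (-1, 0), (0, -1), (-1, -1)],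
      ∀ i j,
        d.1 * (reflectAlong latticeTriangle (netWord n a b c x) i).1 +
            d.2 * (reflectAlong latticeTriangle (netWord n a b c x) i).2 ≤
          d.1 * (reflectAlong latticeTriangle (netWord n a b c y) j).1 +
            d.2 * (reflectAlong latticeTriangle (netWord n a b c y) j).2 := by
  decide +kernel

theorem eq_flip_of_netWord (n : Face) {a b c : Fin 3} (hab : a ≠ b) (hac : a ≠ c) (hbc : b ≠ c)
    {x y : Face} {k : Fin 3} (h : netWord n a b c y = netWord n a b c x ++ [k]) :
    y = x.flip k := by
  have hy := flips_netWord n hab hac hbc y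
  rw [h, Face.flips_append, flips_netWord n hab hac hbc x] at hy
  exact hy.symm

/-- The face before `x` on the walk from `n` to `x` in the net. -/
def netParent (n : Face) (a b c : Fin 3) (x : Face) : Face :=
  n.flips (netWord n a b c x).dropLast

theorem netParent_eq (n : Face) {a b c : Fin 3} (hab : a ≠ b) (hac : a ≠ c) (hbc : b ≠ c)
    {x y : Face} {k : Fin 3} (h : netWord n a b c y = netWord n a b c x ++ [k]) :
    netParent n a b c y = x := by
  rw [netParent, h, List.dropLast_concat, flips_netWord n hab hac hbc]

section Net

variable (n : Face) {a b c : Fin 3} (hab : a ≠ b) (hac : a ≠ c) (hbc : b ≠ c)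

/-- The net whose walks from `n` are described by `netWord`. -/
def net : Face.adjGraph.Subgraph where
  verts := Set.univ
  Adj x y := ∃ k, netWord n a b c y = netWord n a b c x ++ [k] ∨
    netWord n a b c x = netWord n a b c y ++ [k]
  adj_sub := by
    rintro x y ⟨k, h | h⟩
    · exact eq_flip_of_netWord n hab hac hbc h ▸ x.adj_flip k
    · exact (eq_flip_of_netWord n hab hac hbc h ▸ y.adj_flip k : Face.adjGraph.Adj y x).symm
  edge_vert _ := Set.mem_univ _
  symm := ⟨fun x y ⟨k, h⟩ => ⟨k, h.symm⟩⟩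

theorem net_adj_netParent {x : Face} (hx : netWord n a b c x ≠ []) :
    (net n hab hac hbc).Adj (netParent n a b c x) x := by
  refine ⟨(netWord n a b c x).getLast hx, Or.inl ?_⟩
  rw [netParent, netWord_dropLast n hab hac hbc, List.dropLast_append_getLast]

theorem net_connected : (net n hab hac hbc).spanningCoe.Connected := by
  have key : ∀ k, ∀ x : Face, (netWord n a b c x).length = k →
      (net n hab hac hbc).spanningCoe.Reachable n x := by
    intro k
    induction k with
    | zero =>
      intro x hx
      have := flips_netWord n hab hac hbc x
      rw [List.length_eq_zero_iff.1 hx] at this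
      exact this ▸ SimpleGraph.Reachable.refl _
    | succ k ih =>
      intro x hx
      have h0 : netWord n a b c x ≠ [] := fun h => by simp [h] at hx
      refine (ih (netParent n a b c x) ?_).trans
        (SimpleGraph.Adj.reachable (net_adj_netParent n hab hac hbc h0))
      rw [netParent, netWord_dropLast n hab hac hbc, List.length_dropLast, hx]
      rfl
  exact (SimpleGraph.connected_iff_exists_forall_reachable _).2 ⟨n, fun x => key _ x rfl⟩

theorem net_isTree : (net n hab hac hbc).spanningCoe.IsTree := by
  classical
  have hc := net_connected n hab hac hbc
  refine SimpleGraph.isTree_iff_connected_and_card.2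
    ⟨hc, le_antisymm ?_ hc.card_vert_le_card_edgeSet_add_one⟩
  have hsub : (net n hab hac hbc).spanningCoe.edgeSet ⊆
      (fun x => s(netParent n a b c x, x)) '' ((Finset.univ.erase n : Finset Face) : Set Face) := by
    have key : ∀ {x y : Face} {k : Fin 3}, netWord n a b c y = netWord n a b c x ++ [k] →
        y ≠ n ∧ netParent n a b c y = x := fun {x y k} h => by
      refine ⟨?_, netParent_eq n hab hac hbc h⟩
      rintro rfl
      rw [(netWord_flips y hab hac hbc).1] at h
      simp at h
    intro e
    induction e with
    | h x y =>
      rintro ⟨k, h | h⟩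
      · obtain ⟨h1, h2⟩ := key h
        exact ⟨y, by simpa using h1, by simp only [h2]⟩
      · obtain ⟨h1, h2⟩ := key h
        exact ⟨x, by simpa using h1, by simp only [h2]; exact Sym2.eq_swap⟩
  have h1 := Set.ncard_le_ncard hsub (Set.toFinite _)
  have h2 := h1.trans (Set.ncard_image_le (Set.toFinite _))
  rw [Set.ncard_coe_finset, Finset.card_erase_of_mem (Finset.mem_univ _), Finset.card_univ,
    show Fintype.card Face = 8 from rfl] at h2
  rw [Nat.card_eq_fintype_card (α := Face), show Fintype.card Face = 8 from rfl]
  exact Nat.succ_le_succ h2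

/-- The walks that the definition of the net is about stay inside the net. -/
theorem hasWalk_net {w : List (Fin 3)} (h : netWord n a b c (n.flips w) = w) :
    HasWalk (net n hab hac hbc) n w := by
  induction w using List.reverseRecOn with
  | nil => exact Set.mem_univ _
  | append_singleton w k ih =>
    have h' := netWord_dropLast n hab hac hbc (n.flips (w ++ [k]))
    rw [h, List.dropLast_concat] at h'
    refine HasWalk.append_iff.2 ⟨ih h', ⟨k, Or.inl ?_⟩, Set.mem_univ _⟩
    rw [Face.flips_append] at h
    rw [h']
    exact h

end Net

/-! ### The unfolding of the net -/

/-- The unfolding of the net that puts the vertices of the face `n` at the points `P i`. -/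
noncomputable def netMap (n : Face) (a b c : Fin 3) (P : Fin 3 → EuclideanSpace ℝ (Fin 2))
    (x : Face) (p : EuclideanSpace ℝ (Fin 3)) : EuclideanSpace ℝ (Fin 2) :=
  ∑ i, x.bary i p • reflectAlong P (netWord n a b c x) i

theorem dist_sum_smul_eq {E F : Type*} [NormedAddCommGroup E] [InnerProductSpace ℝ E]
    [NormedAddCommGroup F] [InnerProductSpace ℝ F] {P : Fin 3 → E} {Q : Fin 3 → F}
    (hP : IsUnitTriangle P) (hQ : IsUnitTriangle Q) {x y : Fin 3 → ℝ} (hx : ∑ i, x i = 1)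
    (hy : ∑ i, y i = 1) :
    dist (∑ i, x i • P i) (∑ i, y i • P i) = dist (∑ i, x i • Q i) (∑ i, y i • Q i) := by
  have e : ∀ i j, dist (P i) (P j) = dist (Q i) (Q j) := fun i j => by
    rcases eq_or_ne i j with rfl | h
    · rw [dist_self, dist_self]
    · rw [hP _ _ h, hQ _ _ h]
  rw [← sq_eq_sq₀ dist_nonneg dist_nonneg, sq_dist_sum_smul hx hy, sq_dist_sum_smul hx hy]
  simp only [e]

section NetMap

variable (n : Face) {a b c : Fin 3} (hab : a ≠ b) (hac : a ≠ c) (hbc : b ≠ c)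
  {P : Fin 3 → EuclideanSpace ℝ (Fin 2)}

theorem netMap_vertexAt (x : Face) (i : Fin 3) :
    netMap n a b c P x (x.vertexAt i).pos = reflectAlong P (netWord n a b c x) i := by
  simp [netMap, Face.bary_pos_vertexAt]

theorem isUnfolding_netMap (hP : IsUnitTriangle P) (ho : 0 < orientedArea P * n.handedness) :
    IsUnfolding (net n hab hac hbc) (netMap n a b c P) where
  isometric x _ p hp q hq := by
    have h := dist_sum_smul_eq (hP.reflectAlong (netWord n a b c x))
      (fun i j hij => x.dist_pos_vertexAt hij) ((x.mem_carrier_iff p).1 hp).2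
      ((x.mem_carrier_iff q).1 hq).2
    rwa [x.sum_bary_smul, x.sum_bary_smul] at h
  exterior_up x _ u hu v hv w hw h := by
    obtain ⟨i, rfl⟩ := (x.mem_verts_iff _).1 hu
    obtain ⟨j, rfl⟩ := (x.mem_verts_iff _).1 hv
    obtain ⟨k, rfl⟩ := (x.mem_verts_iff _).1 hw
    have h2 := x.two_mul_det_coords i j k
    rw [Vertex.Counterclockwise] at h
    rw [netMap_vertexAt, netMap_vertexAt, netMap_vertexAt, planeCounterclockwise_iff,
      orientedArea_reflectAlong]
    have hh := n.handedness_flips (netWord n a b c x)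
    rw [flips_netWord n hab hac hbc] at hh
    set δ : ℤ := ((j : ℤ) - i) * ((k : ℤ) - i) * ((k : ℤ) - j)
    have hδ : 0 < x.handedness * δ := by omega
    rw [hh] at hδ
    have hδ' : (0 : ℝ) < (-1) ^ (netWord n a b c x).length * n.handedness * δ := by
      exact_mod_cast hδ
    have e : (n.handedness : ℝ) * n.handedness = 1 := by
      rcases n.handedness_eq with e | e <;> rw [e] <;> norm_num
    have := mul_pos ho hδ'
    calc (0 : ℝ) < _ := this
      _ = (-1) ^ (netWord n a b c x).length * orientedArea P * δ *
          ((n.handedness : ℝ) * n.handedness) := by ring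
      _ = _ := by rw [e, mul_one]
  glued := by
    have key : ∀ x y k, netWord n a b c y = netWord n a b c x ++ [k] →
        ∀ p ∈ x.carrier, p ∈ y.carrier → netMap n a b c P x p = netMap n a b c P y p := by
      intro x y k h p hx hy
      rw [eq_flip_of_netWord n hab hac hbc h] at hy
      have h0 := Face.bary_eq_zero hx hy
      rw [netMap, netMap, h, reflectAlong_append, eq_flip_of_netWord n hab hac hbc h]
      refine Finset.sum_congr rfl fun i _ => ?_
      rw [Face.bary_flip]
      split_ifs with hi
      · rw [hi, h0, neg_zero, zero_smul, zero_smul]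
      · exact congrArg _ (reflectAt_of_ne _ hi).symm
    rintro x y ⟨k, h | h⟩ p ⟨hx, hy⟩
    · exact key x y k h p hx hy
    · exact (key y x k h p hy hx).symm

end NetMap

/-! ### The standard position of a face -/

/-- The embedding of the triangular lattice in the plane, for a face of handedness `e`. For `e = 1`
the unit vectors are mapped to `(1, 0)` and `(1 / 2, √3 / 2)`; for `e = -1` the image is reflected,
`(0, 0)` and `(1, 0)` being exchanged. -/
noncomputable def latticePoint (e : ℤ) (z : ℤ × ℤ) : EuclideanSpace ℝ (Fin 2) :=
  !₂[(1 - e) / 2 + e * (z.1 + z.2 / 2), z.2 * (√3 / 2)]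

theorem reflectAlong_latticePoint (e : ℤ) (L : Fin 3 → ℤ × ℤ) (w : List (Fin 3)) (i : Fin 3) :
    reflectAlong (fun i => latticePoint e (L i)) w i = latticePoint e (reflectAlong L w i) := by
  induction w generalizing L with
  | nil => rfl
  | cons k w ih =>
    rw [reflectAlong, reflectAlong, ← ih]
    congr 1
    funext j
    ext l
    fin_cases k <;> fin_cases j <;> fin_cases l <;> simp [reflectAt, latticePoint] <;> ring

theorem isUnitTriangle_latticePoint {e : ℤ} (he : e = 1 ∨ e = -1) :
    IsUnitTriangle fun i => latticePoint e (latticeTriangle i) := by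
  have h3 : (√3 : ℝ) ^ 2 = 3 := Real.sq_sqrt (by norm_num)
  intro i j hij
  rw [dist_eq_one_iff]
  rcases he with rfl | rfl <;> fin_cases i <;> fin_cases j <;>
    first
    | exact absurd rfl hij
    | (simp [latticePoint, latticeTriangle, div_pow, h3]; try norm_num)

theorem orientedArea_latticePoint (e : ℤ) :
    orientedArea (fun i => latticePoint e (latticeTriangle i)) = e * (√3 / 2) := by
  simp [orientedArea, latticePoint, latticeTriangle]

/-- Sets on different sides of a line have disjoint interiors. -/
theorem disjoint_interior_of_le {E : Type*} [NormedAddCommGroup E] [NormedSpace ℝ E]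
    {f : E →L[ℝ] ℝ} (hf : f ≠ 0) {X Y : Set E} (h : ∀ x ∈ X, ∀ y ∈ Y, f x ≤ f y) :
    Disjoint (interior X) (interior Y) := by
  rw [Set.disjoint_iff]
  rintro q ⟨hX, hY⟩
  have hopen := f.isOpenMap_of_ne_zero hf _ (isOpen_interior.inter (isOpen_interior (s := Y)) :
    IsOpen (interior X ∩ interior Y))
  have : f '' (interior X ∩ interior Y) = {f q} := by
    refine Set.eq_singleton_iff_unique_mem.2 ⟨⟨q, ⟨hX, hY⟩, rfl⟩, ?_⟩
    rintro _ ⟨r, ⟨rX, rY⟩, rfl⟩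
    exact le_antisymm (h _ (interior_subset rX) _ (interior_subset hY))
      (h _ (interior_subset hX) _ (interior_subset rY))
  rw [this] at hopen
  exact not_isOpen_singleton _ hopen

/-- The linear functional on the plane that extends `d.1 * z.1 + d.2 * z.2` on the lattice, up to an
additive constant. -/
noncomputable def latticeFunctional (e : ℤ) (d : ℤ × ℤ) : EuclideanSpace ℝ (Fin 2) →L[ℝ] ℝ :=
  ((d.1 : ℝ) * e) • EuclideanSpace.proj 0 +
    ((2 * d.2 - d.1 : ℝ) / √3) • EuclideanSpace.proj 1

theorem latticeFunctional_latticePoint {e : ℤ} (he : e = 1 ∨ e = -1) (d z : ℤ × ℤ) :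
    latticeFunctional e d (latticePoint e z) =
      ((d.1 * z.1 + d.2 * z.2 : ℤ) : ℝ) + d.1 * e * (1 - e) / 2 := by
  have h3 : (√3 : ℝ) ≠ 0 := by positivity
  simp only [latticeFunctional, latticePoint, add_apply,
    smul_apply, PiLp.proj_apply, smul_eq_mul]
  rcases he with rfl | rfl <;> simp <;> field_simp <;> ring

theorem latticeFunctional_ne_zero {e : ℤ} (he : e = 1 ∨ e = -1) {d : ℤ × ℤ} (hd : d ≠ 0) :
    latticeFunctional e d ≠ 0 := by
  intro h
  have h0 := latticeFunctional_latticePoint he d (0, 0)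
  have h1 := latticeFunctional_latticePoint he d (1, 0)
  have h2 := latticeFunctional_latticePoint he d (0, 1)
  rw [h] at h0 h1 h2
  simp only [zero_apply] at h0 h1 h2
  push_cast at h0 h1 h2
  refine hd (Prod.ext ?_ ?_)
  · have : (d.1 : ℝ) = 0 := by linarith
    exact_mod_cast this
  · have : (d.2 : ℝ) = 0 := by linarith
    exact_mod_cast this

section Standard

variable (n : Face) {a b c : Fin 3} (hab : a ≠ b) (hac : a ≠ c) (hbc : b ≠ c)

/-- The unfolding of the net in which the edge of `n` between the axes `0` and `1` is the segment
from `(0, 0)` to `(1, 0)`, and `n` is above it. -/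
noncomputable abbrev standardMap (n : Face) (a b c : Fin 3) :=
  netMap n a b c fun i => latticePoint n.handedness (latticeTriangle i)

theorem isUnfolding_standardMap :
    IsUnfolding (net n hab hac hbc) (standardMap n a b c) := by
  refine isUnfolding_netMap n hab hac hbc (isUnitTriangle_latticePoint n.handedness_eq) ?_
  rw [orientedArea_latticePoint]
  rcases n.handedness_eq with e | e <;> rw [e] <;> norm_num

theorem isNet_net : IsNet (net n hab hac hbc) := by
  refine ⟨fun _ => Set.mem_univ _, net_isTree n hab hac hbc, standardMap n a b c,
    isUnfolding_standardMap n hab hac hbc, fun x y hxy => ?_⟩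
  obtain ⟨d, hd, h⟩ := netWord_separated n hab hac hbc x y hxy
  have hd0 : d ≠ 0 := by
    rintro rfl
    revert hd
    decide
  refine disjoint_interior_of_le (latticeFunctional_ne_zero n.handedness_eq hd0) ?_
  rintro _ ⟨p, hp, rfl⟩ _ ⟨q, hq, rfl⟩
  obtain ⟨p0, p1⟩ := (x.mem_carrier_iff p).1 hp
  obtain ⟨q0, q1⟩ := (y.mem_carrier_iff q).1 hq
  simp only [standardMap, netMap, map_sum, map_smul, reflectAlong_latticePoint,
    latticeFunctional_latticePoint n.handedness_eq, smul_eq_mul, mul_add,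
    Finset.sum_add_distrib, ← Finset.sum_mul, p1, q1, one_mul]
  refine add_le_add_left ?_ _
  calc _ = ∑ i, ∑ j, x.bary i p * y.bary j q * _ :=
        Finset.sum_congr rfl fun i _ => by
          rw [← Finset.sum_mul, ← Finset.mul_sum, q1, mul_one]
    _ ≤ ∑ i, ∑ j, x.bary i p * y.bary j q * _ :=
        Finset.sum_le_sum fun i _ => Finset.sum_le_sum fun j _ =>
          mul_le_mul_of_nonneg_left (Int.cast_le.2 (h i j)) (mul_nonneg (p0 i) (q0 j))
    _ = _ := by
        rw [Finset.sum_comm]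
        refine Finset.sum_congr rfl fun j _ => ?_
        rw [← Finset.sum_mul, ← Finset.sum_mul, p1, one_mul]

theorem isOrientation_standardMap {L : Landscape} (hL : L.dual ≤ net n hab hac hbc)
    (hn : n ∈ L.dual.verts) : L.IsOrientation n (n.flip 2) (standardMap n a b c) := by
  have e : ∀ p, standardMap n a b c n p =
      ∑ i, n.bary i p • latticePoint n.handedness (latticeTriangle i) := fun p => by
    rw [standardMap, netMap, (netWord_flips n hab hac hbc).1]
    rfl
  refine ⟨hn, n.adj_flip 2, (isUnfolding_standardMap n hab hac hbc).mono hL, fun p hp => ?_, ?_⟩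
  · rw [e, Fin.sum_univ_three]
    have := ((n.mem_carrier_iff p).1 hp).1 2
    simp [latticePoint, latticeTriangle]
    positivity
  · have hseg : segment ℝ (latticePoint n.handedness (latticeTriangle 0))
        (latticePoint n.handedness (latticeTriangle 1)) =
        segment ℝ (!₂[0, 0] : EuclideanSpace ℝ (Fin 2)) !₂[1, 0] := by
      rcases n.handedness_eq with h | h
      · rw [h]
        congr 1 <;> (ext i; fin_cases i <;> simp [latticePoint, latticeTriangle])
      · rw [h, segment_symm]
        congr 1 <;> (ext i; fin_cases i <;> simp [latticePoint, latticeTriangle])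
    rw [← hseg]
    ext q
    constructor
    · rintro ⟨p, ⟨h1, h2⟩, rfl⟩
      have h0 := Face.bary_eq_zero h1 h2
      obtain ⟨p0, p1⟩ := (n.mem_carrier_iff p).1 h1
      rw [Fin.sum_univ_three, h0, add_zero] at p1
      refine ⟨n.bary 0 p, n.bary 1 p, p0 0, p0 1, p1, ?_⟩
      rw [e, Fin.sum_univ_three, h0, zero_smul, add_zero]
    · rintro ⟨s, t, hs, ht, hst, rfl⟩
      have hx0 : ∀ i, 0 ≤ (![s, t, 0] : Fin 3 → ℝ) i := fun i => by
        fin_cases i <;> simp [hs, ht]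
      have h1 := n.sum_smul_mem_carrier hx0 (by simpa [Fin.sum_univ_three] using hst)
      refine ⟨_, ⟨h1, Face.mem_carrier_flip h1 ?_⟩, ?_⟩
      · rw [n.bary_sum_smul]; rfl
      · rw [e]
        simp only [n.bary_sum_smul]
        simp [Fin.sum_univ_three]

end Standard

/-! ### The nine landscapes -/

/-- The words of the walks from `F1` to the faces. -/
def axesFromF1 : Face → List (Fin 3)
  | .F1 => []
  | .F2 => [0]
  | .F3 => [0, 2]
  | .F4 => [2]
  | .F5 => [0, 1]
  | .F6 => [1]
  | .F7 => [2, 1]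
  | .F8 => [0, 1, 2]

/-- The symmetry of the octahedron that maps `F1` to `n` and permutes the axes by `π`. -/
def faceMap (n : Face) (π : Fin 3 → Fin 3) (x : Face) : Face := n.flips ((axesFromF1 x).map π)

/-- The product `(j - i) (k - i) (k - j)` is twice the sign of `(i, j, k)` as a permutation of
`(0, 1, 2)`. -/
theorem det_centre_flip (n : Face) (i j k : Fin 3) :
    Matrix.det (Matrix.of ![(n.flip i).centre, (n.flip j).centre, (n.flip k).centre]) =
      2 * (n.handedness * (((j : ℤ) - i) * ((k : ℤ) - i) * ((k : ℤ) - j))) := by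
  rw [Matrix.det_fin_three]
  simp only [Matrix.of_apply, Matrix.cons_val]
  revert n i j k
  decide +kernel

theorem clockwiseAround_flip {n : Face} {i j k : Fin 3}
    (h : n.handedness * (((j : ℤ) - i) * ((k : ℤ) - i) * ((k : ℤ) - j)) < 0) :
    n.ClockwiseAround (n.flip i) (n.flip j) (n.flip k) := by
  refine ⟨n.adj_flip i, n.adj_flip j, n.adj_flip k, ?_⟩
  rw [det_centre_flip]
  omega

/-- The permutations of the axes. -/
def axisPerms : List (Fin 3 → Fin 3) :=
  [![0, 1, 2], ![1, 2, 0], ![2, 0, 1], ![0, 2, 1], ![2, 1, 0], ![1, 0, 2]]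

theorem faceMap_injective (n : Face) : ∀ π ∈ axisPerms, ∀ x y : Face,
    faceMap n π x = faceMap n π y → x = y := by
  revert n
  decide +kernel

theorem disjoint_verts_faceMap (n : Face) : ∀ π ∈ axisPerms,
    Disjoint (faceMap n π .F1).verts (faceMap n π .F8).verts ∧
    Disjoint (faceMap n π .F2).verts (faceMap n π .F7).verts ∧
    Disjoint (faceMap n π .F3).verts (faceMap n π .F6).verts ∧
    Disjoint (faceMap n π .F4).verts (faceMap n π .F5).verts := by
  revert n
  decide +kernel

theorem exists_axisPerm (n : Face) : ∀ w ∈ straightWords, ∃ π ∈ axisPerms,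
    n.handedness * (((π 2 : ℤ) - π 0) * ((π 1 : ℤ) - π 0) * ((π 1 : ℤ) - π 2)) < 0 ∧
      ∃ a : Fin 9, (nineLists a).map (faceMap n π) = n.trail w := by
  revert n
  decide +kernel

/-- The walks of the words without repeated letters belong to the nine landscapes. -/
theorem exists_isLabelling (n : Face) {w : List (Fin 3)} (hw : w ∈ straightWords) :
    ∃ σ : Equiv.Perm Face, IsLabelling σ ∧ ∃ a : Fin 9, (nineLists a).map σ = n.trail w := by
  obtain ⟨π, hπ, ho, a, ha⟩ := exists_axisPerm n w hw
  refine ⟨Equiv.ofBijective (faceMap n π)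
    (Finite.injective_iff_bijective.1 fun x y => faceMap_injective n π hπ x y), ?_, a, ha⟩
  obtain ⟨h1, h2, h3, h4⟩ := disjoint_verts_faceMap n π hπ
  exact ⟨h1, h2, h3, h4, clockwiseAround_flip ho⟩

theorem nodup_trail_of_mem : ∀ w ∈ straightWords, ∀ n : Face, (n.trail w).Nodup := by
  decide +kernel

/-- Every word without repeated letters belongs to a landscape, which has an orientation. -/
theorem exists_landscape (n : Face) {w : List (Fin 3)} (hw : w ∈ straightWords) :
    ∃ L : Landscape, L.dual = (n.wordWalk w).toSubgraph ∧
      ∃ g, L.IsOrientation n (n.flip 2) g := by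
  obtain ⟨a, b, c, hab, hac, hbc, h⟩ := exists_straight w hw
  have hnet : HasWalk (net n hab hac hbc) n w := by
    obtain ⟨-, h1, h2, h3⟩ := netWord_flips n hab hac hbc
    rcases h with rfl | rfl | rfl
    · exact hasWalk_net n hab hac hbc h1
    · exact hasWalk_net n hab hac hbc h2
    · exact hasWalk_net n hab hac hbc h3
  have hle := Face.toSubgraph_wordWalk_le hnet
  have hlen : 2 ≤ (n.trail w).length := by
    rw [Face.length_trail]
    rcases h with rfl | rfl | rfl <;> simp
  refine ⟨⟨(n.wordWalk w).toSubgraph, ⟨n.trail w, hlen, n, _, n.wordWalk w, ?_,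
    n.support_wordWalk w, rfl⟩, net n hab hac hbc, isNet_net n hab hac hbc, hle⟩, rfl,
    standardMap n a b c, isOrientation_standardMap n hab hac hbc hle
      (n.hasWalk_toSubgraph w).mem_verts⟩
  rw [SimpleGraph.Walk.isPath_def, n.support_wordWalk]
  exact nodup_trail_of_mem w hw n

/-! ### Trails -/

namespace Landscape

variable {L : Landscape}

theorem trailLength_le {n m : Face}
    {g : Face → EuclideanSpace ℝ (Fin 3) → EuclideanSpace ℝ (Fin 2)} (hg : L.IsOrientation n m g)
    {w : List (Fin 3)} (h : HasWalk L.dual n w) (hw : w ∈ straightWords)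
    {p₁ p₂ : EuclideanSpace ℝ (Fin 3)} (h₁ : p₁ ∈ n.carrier) (h₂ : p₂ ∈ (n.flips w).carrier) :
    L.trailLength p₁ p₂ ≤ edist (g n p₁) (g (n.flips w) p₂) :=
  sInf_le ⟨n, m, g, hg, _, ⟨n, h.mem_verts, h₁, rfl⟩, _, ⟨_, h.flips_mem_verts, h₂, rfl⟩,
    hg.unfolding.segment_subset h hw h₁ h₂, rfl⟩

theorem trailLength_le_edist {n m : Face}
    {g : Face → EuclideanSpace ℝ (Fin 3) → EuclideanSpace ℝ (Fin 2)} (hg : L.IsOrientation n m g)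
    {p₁ p₂ : EuclideanSpace ℝ (Fin 3)} (h₁ : p₁ ∈ n.carrier) (h₂ : p₂ ∈ n.carrier) :
    L.trailLength p₁ p₂ ≤ edist p₁ p₂ := by
  have hu := hg.unfolding
  have e : edist p₁ p₂ = edist (g n p₁) (g n p₂) := by
    rw [edist_dist, edist_dist, hu.isometric n hg.mem _ h₁ _ h₂]
  refine sInf_le ⟨n, m, g, hg, _, ⟨n, hg.mem, h₁, rfl⟩, _, ⟨n, hg.mem, h₂, rfl⟩, ?_, e⟩
  rintro _ ⟨s, t, hs, ht, hst, rfl⟩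
  refine Set.mem_biUnion hg.mem ?_
  obtain ⟨x0, x1⟩ := (n.mem_carrier_iff p₁).1 h₁
  obtain ⟨y0, y1⟩ := (n.mem_carrier_iff p₂).1 h₂
  rw [hu.apply_eq hg.mem h₁, hu.apply_eq hg.mem h₂, Finset.smul_sum, Finset.smul_sum,
    ← Finset.sum_add_distrib]
  simp only [smul_smul, ← add_smul]
  refine hu.sum_smul_placed_mem hg.mem
    (fun i => add_nonneg (mul_nonneg hs (x0 i)) (mul_nonneg ht (y0 i))) ?_
  rw [Finset.sum_add_distrib, ← Finset.mul_sum, ← Finset.mul_sum, x1, y1, mul_one, mul_one, hst]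

theorem dual_connected (L : Landscape) : L.dual.Connected := by
  obtain ⟨l, -, a, b, w, -, -, h⟩ := L.exists_path
  rw [h]
  exact w.toSubgraph_connected

theorem exists_adj {n : Face} (hn : n ∈ L.dual.verts) : ∃ k, L.dual.Adj n (n.flip k) := by
  obtain ⟨l, hl, a, b, w, hw, rfl, h⟩ := L.exists_path
  obtain ⟨m, hm, hmn⟩ : ∃ m ∈ L.dual.verts, m ≠ n := by
    have h2 : 2 ≤ w.support.toFinset.card := by
      rwa [List.toFinset_card_of_nodup hw.support_nodup]
    obtain ⟨m, hm, hmn⟩ := Finset.exists_mem_ne h2 n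
    refine ⟨m, ?_, hmn⟩
    rw [h, SimpleGraph.Walk.mem_verts_toSubgraph]
    exact List.mem_toFinset.1 hm
  obtain ⟨v, hv, rfl, -⟩ := exists_hasWalk L.dual_connected hn hm
  cases v with
  | nil => exact absurd rfl hmn
  | cons k v => exact ⟨k, hv.1⟩

theorem trail_set_finite (L : Landscape) (p₁ p₂ : EuclideanSpace ℝ (Fin 3)) :
    {d | ∃ n m g, L.IsOrientation n m g ∧ ∃ q₁ ∈ L.places g p₁, ∃ q₂ ∈ L.places g p₂,
      segment ℝ q₁ q₂ ⊆ L.region g ∧ d = edist q₁ q₂}.Finite := by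
  let S : Face → Face → Set ℝ≥0∞ := fun x y => {d | ∃ g, IsUnfolding L.dual g ∧
    x ∈ L.dual.verts ∧ y ∈ L.dual.verts ∧ p₁ ∈ x.carrier ∧ p₂ ∈ y.carrier ∧
      d = edist (g x p₁) (g y p₂)}
  have hS : ∀ x y, (S x y).Subsingleton := by
    rintro x y _ ⟨g, hg, hx, hy, h₁, h₂, rfl⟩ _ ⟨g', hg', -, -, -, -, rfl⟩
    obtain ⟨w, hw, rfl, -⟩ := exists_hasWalk L.dual_connected hx hy
    rw [edist_dist, edist_dist, hg.dist_eq_dist hg' hw hw h₁ h₂]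
  refine (Set.finite_iUnion fun x => Set.finite_iUnion fun y => (hS x y).finite).subset ?_
  rintro _ ⟨n, m, g, hg, _, ⟨x, hx, h₁, rfl⟩, _, ⟨y, hy, h₂, rfl⟩, -, rfl⟩
  exact Set.mem_iUnion₂.2 ⟨x, y, g, hg.unfolding, hx, hy, h₁, h₂, rfl⟩

/-- A trail of finite length is the image of a segment in some orientation. -/
theorem exists_trailLength_eq {p₁ p₂ : EuclideanSpace ℝ (Fin 3)}
    (h : L.trailLength p₁ p₂ ≠ ⊤) : ∃ g, IsUnfolding L.dual g ∧ ∃ x ∈ L.dual.verts,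
      ∃ y ∈ L.dual.verts, p₁ ∈ x.carrier ∧ p₂ ∈ y.carrier ∧
        L.trailLength p₁ p₂ = edist (g x p₁) (g y p₂) := by
  have hne : {d | ∃ n m g, L.IsOrientation n m g ∧ ∃ q₁ ∈ L.places g p₁, ∃ q₂ ∈ L.places g p₂,
      segment ℝ q₁ q₂ ⊆ L.region g ∧ d = edist q₁ q₂}.Nonempty := by
    rw [Set.nonempty_iff_ne_empty]
    intro h0
    exact h (by rw [trailLength, h0, sInf_empty])
  obtain ⟨n, m, g, hg, _, ⟨x, hx, h₁, rfl⟩, _, ⟨y, hy, h₂, rfl⟩, -, e⟩ :=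
    hne.csInf_mem (L.trail_set_finite p₁ p₂)
  exact ⟨g, hg.unfolding, x, hx, y, hy, h₁, h₂, e⟩

theorem isOneOfNine_of_dual_eq {n : Face} {w : List (Fin 3)} (hw : w ∈ straightWords)
    (h : L.dual = (n.wordWalk w).toSubgraph) :
    ∃ σ : Equiv.Perm Face, IsLabelling σ ∧ L.IsOneOfNine σ := by
  obtain ⟨σ, hσ, a, ha⟩ := exists_isLabelling n hw
  refine ⟨σ, hσ, a, n, _, n.wordWalk w, ?_, ?_, h⟩
  · rw [SimpleGraph.Walk.isPath_def, n.support_wordWalk]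
    exact nodup_trail_of_mem w hw n
  · rw [n.support_wordWalk, ha]

theorem mem_carrier {n : Face} (hn : n ∈ L.dual.verts) {p : EuclideanSpace ℝ (Fin 3)}
    (hp : p ∈ n.carrier) : p ∈ L.carrier :=
  Set.mem_biUnion hn hp

/-- The trail of a valid landscape other than the nine ones cannot join two faces along any walk: if
the walk has no repeated letters, the landscape of this walk is a sublandscape with the same trail;
otherwise the walk has a shortcut, unless it can be shortened because an end point lies on the next
face. -/
theorem not_trailLength_eq (hL : ∀ σ : Equiv.Perm Face, IsLabelling σ → ¬ L.IsOneOfNine σ)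
    {p₁ p₂ : EuclideanSpace ℝ (Fin 3)}
    (hval : ∀ L' : Landscape, L' ≠ L → p₁ ∈ L'.carrier → p₂ ∈ L'.carrier →
      L.trailLength p₁ p₂ ≤ L'.trailLength p₁ p₂ ∧
      (L.trailLength p₁ p₂ = L'.trailLength p₁ p₂ → ¬ L'.IsSublandscape L))
    {g : Face → EuclideanSpace ℝ (Fin 3) → EuclideanSpace ℝ (Fin 2)} (hg : IsUnfolding L.dual g)
    {n : Face} {w : List (Fin 3)} (h : HasWalk L.dual n w) (hnd : (n.trail w).Nodup)
    (h₁ : p₁ ∈ n.carrier) (h₂ : p₂ ∈ (n.flips w).carrier) :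
    L.trailLength p₁ p₂ ≠ edist (g n p₁) (g (n.flips w) p₂) := by
  have not_sub : ∀ {m : Face} {v : List (Fin 3)}, v ∈ straightWords → HasWalk L.dual m v →
      ∀ {L' : Landscape}, L'.dual = (m.wordWalk v).toSubgraph → p₁ ∈ L'.carrier →
        p₂ ∈ L'.carrier → ¬ L'.trailLength p₁ p₂ ≤ L.trailLength p₁ p₂ := by
    intro m v hv hm L' hL' c₁ c₂ hle
    have hne : L' ≠ L := by
      rintro rfl
      obtain ⟨σ, hσ, h9⟩ := isOneOfNine_of_dual_eq hv hL'
      exact hL σ hσ h9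
    obtain ⟨i, ii⟩ := hval L' hne c₁ c₂
    refine ii (le_antisymm i hle) ?_
    rw [IsSublandscape, hL']
    exact Face.toSubgraph_wordWalk_le hm
  intro heq
  induction hk : w.length using Nat.strong_induction_on generalizing n w with
  | _ k ih =>
  subst hk
  by_cases h0 : w = []
  · -- Both places are on the same face; `n` and any neighbour form a sublandscape.
    subst h0
    obtain ⟨k, hk⟩ := exists_adj h.mem_verts
    have hkw : [k] ∈ straightWords := by fin_cases k <;> decide
    obtain ⟨L', hL', g', hg'⟩ := exists_landscape n hkw
    refine not_sub hkw ⟨hk, L.dual.edge_vert hk.symm⟩ hL' (mem_carrier hg'.mem h₁)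
      (mem_carrier hg'.mem h₂) ((trailLength_le_edist hg' h₁ h₂).trans_eq ?_)
    rw [heq, edist_dist, edist_dist]
    exact congrArg _ (hg.isometric n h.mem_verts _ h₁ _ h₂).symm
  by_cases hw : w ∈ straightWords
  · -- The walk itself is a sublandscape with a trail of the same length.
    obtain ⟨L', hL', g', hg'⟩ := exists_landscape n hw
    have h' : HasWalk L'.dual n w := hL' ▸ n.hasWalk_toSubgraph w
    refine not_sub hw h hL' (mem_carrier hg'.mem h₁) (mem_carrier h'.flips_mem_verts h₂)
      ((trailLength_le hg' h' hw h₁ h₂).trans_eq ?_)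
    rw [heq, edist_dist, edist_dist, hg'.unfolding.dist_eq_dist hg h' h h₁ h₂]
  by_cases k₁ : n.bary (w.headD 0) p₁ = 0
  · -- The first point is also on the second face, at the same place: drop the first face.
    obtain ⟨k, v, rfl⟩ := List.exists_cons_of_ne_nil h0
    have h₁' := Face.mem_carrier_flip h₁ k₁
    refine ih v.length (by simp) h.2 hnd.of_cons h₁' h₂ ?_ rfl
    rw [heq, hg.glued _ _ h.1 _ ⟨h₁, h₁'⟩]
    rfl
  by_cases k₂ : (n.flips w).bary (w.getLastD 0) p₂ = 0
  · -- Likewise, drop the last face.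
    obtain ⟨v, k, rfl⟩ : ∃ v k, w = v ++ [k] :=
      ⟨w.dropLast, w.getLast h0, (List.dropLast_append_getLast h0).symm⟩
    obtain ⟨hv, hvk⟩ := HasWalk.append_iff.1 h
    rw [List.getLastD_concat] at k₂
    have e : n.flips (v ++ [k]) = (n.flips v).flip k := Face.flips_append _ _ _
    have h₂' := Face.mem_carrier_flip h₂ k₂
    rw [e, Face.flip_flip] at h₂'
    rw [Face.trail_append_singleton] at hnd
    refine ih v.length (by simp) hv hnd.of_append_left h₁ h₂' ?_ rfl
    rw [heq, e]
    rw [e] at h₂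
    rw [hg.glued _ _ hvk.1 _ ⟨h₂', h₂⟩]
  · obtain ⟨w', hw', hs⟩ := exists_isShortcut hnd h0 hw
    obtain ⟨L', hL', g', hg'⟩ := exists_landscape n hw'
    have h' : HasWalk L'.dual n w' := hL' ▸ n.hasWalk_toSubgraph w'
    have h₂' : p₂ ∈ (n.flips w').carrier := Face.flips_eq_of_F1 hs.1 n ▸ h₂
    have hlt : L'.trailLength p₁ p₂ < L.trailLength p₁ p₂ := by
      refine (trailLength_le hg' h' hw' h₁ h₂').trans_lt ?_
      rw [heq, edist_dist, edist_dist]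
      have := hg.dist_lt_of_isShortcut hg'.unfolding h h' hs h₁ h₂ k₁ k₂
      exact (ENNReal.ofReal_lt_ofReal_iff (dist_nonneg.trans_lt this)).2 this
    have hne : L' ≠ L := by
      rintro rfl
      exact hlt.false
    exact absurd (hval L' hne (mem_carrier hg'.mem h₁) (mem_carrier h'.flips_mem_verts h₂')).1
      (not_le.2 hlt)

/-- Any two points of two faces are joined by a trail in one of the nine landscapes. -/
theorem exists_trailLength_ne_top {x y : Face} {p₁ p₂ : EuclideanSpace ℝ (Fin 3)}
    (h₁ : p₁ ∈ x.carrier) (h₂ : p₂ ∈ y.carrier) : ∃ w ∈ straightWords, ∃ L : Landscape,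
      L.dual = (x.wordWalk w).toSubgraph ∧ p₁ ∈ L.carrier ∧ p₂ ∈ L.carrier ∧
        L.trailLength p₁ p₂ ≠ ⊤ := by
  obtain ⟨w, hw, h⟩ : ∃ w ∈ straightWords, x = y ∨ x.flips w = y := by
    clear h₁ h₂
    revert x y
    decide
  obtain ⟨L, hL, g, hg⟩ := exists_landscape x hw
  have h' : HasWalk L.dual x w := hL ▸ x.hasWalk_toSubgraph w
  refine ⟨w, hw, L, hL, mem_carrier hg.mem h₁, ?_⟩
  rcases h with rfl | rfl
  · exact ⟨mem_carrier hg.mem h₂,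
      ((trailLength_le_edist hg h₁ h₂).trans_lt (edist_lt_top _ _)).ne⟩
  · exact ⟨mem_carrier h'.flips_mem_verts h₂,
      ((trailLength_le hg h' hw h₁ h₂).trans_lt (edist_lt_top _ _)).ne⟩

end Landscape

theorem mainTheorem1 (L : Landscape)
    (hL : ∀ σ : Equiv.Perm Face, IsLabelling σ → ¬ L.IsOneOfNine σ) :
    ¬ L.IsValid := by
  rintro ⟨p₁, hp₁, p₂, hp₂, hval⟩
  obtain ⟨x, -, h₁⟩ := Set.mem_iUnion₂.1 hp₁
  obtain ⟨y, -, h₂⟩ := Set.mem_iUnion₂.1 hp₂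
  obtain ⟨w, hw, L', hL', c₁, c₂, hfin⟩ := Landscape.exists_trailLength_ne_top h₁ h₂
  have hne : L' ≠ L := by
    rintro rfl
    obtain ⟨σ, hσ, h9⟩ := Landscape.isOneOfNine_of_dual_eq hw hL'
    exact hL σ hσ h9
  have hL_fin : L.trailLength p₁ p₂ ≠ ⊤ :=
    ((hval L' hne c₁ c₂).1.trans_lt (lt_top_iff_ne_top.2 hfin)).ne
  obtain ⟨g, hg, x, hx, y, hy, h₁, h₂, heq⟩ := Landscape.exists_trailLength_eq hL_fin
  obtain ⟨w, hw, rfl, hnd⟩ := exists_hasWalk L.dual_connected hx hy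
  exact Landscape.not_trailLength_eq hL hval hg hw hnd h₁ h₂ heq
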